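/- Let $m$ be normalized Lebesgue measure on the unit circle $\mathbb T$, $L^2=L^2(\mathbb T,m)$, let $H^2\subset L^2$ and $H^\infty$ be the Hardy spaces on $\mathbb T$, $P_+$ the orthogonal projection of $L^2$ onto $H^2$, $\chi(\zeta)=\zeta$, and $S$ the operator of multiplication by $\chi$ on $H^2$. Write $(x\otimes y)f=(f,y)x$, let $P_{\mathcal M}$ be the orthogonal projection onto a closed subspace $\mathcal M$, and for an inner function $\vartheta$ (unimodular constants allowed) put $\mathcal K_\vartheta=H^2\ominus\vartheta H^2$. If $\vartheta(0)=0$, put $U(\vartheta)=P_{\mathcal K_\vartheta}S|_{\mathcal K_\vartheta}+\mathbf 1\otimes\overline\chi\vartheta$, an operator on $\mathcal K_\vartheta$. A bounded operator is a quasiaffinity if it has zero kernel and dense range, and $T$ is expansive if $\|Tx\|\ge\|x\|$ for all $x$. **Theorem.** Let $\theta,\beta\in H^\infty$ be inner functions with $\theta(0)=0$, let $a,b\in\mathbb C$, and suppose that $\varphi=a+b(\theta-1)\not\equiv0$. Define bounded operators $T,X,Y$ on $H^2$ by $$T=S+(1+(a-1)\theta)\beta\otimes\beta\overline\chi\theta+b\,\theta\beta\otimes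 P_+\overline\chi\beta,$$ $$X(\theta\beta h+\beta f+g)=(\theta-1)\beta h+a\beta f+\varphi g\qquad(h\in H^2,\ f\in\mathcal K_\theta,\ g\in\mathcal K_\beta),$$ $$Y(\beta h+g)=\theta\beta\varphi h+\theta P_{\beta H^2}(\varphi g)+(\theta-1)g\qquad(h\in H^2,\ g\in\mathcal K_\beta).$$ Then $\theta\beta H^2$ and $\beta H^2$ are closed invariant subspaces of $T$, the compression $P_{\beta\mathcal K_\theta}T|_{\beta\mathcal K_\theta}$ is unitarily equivalent to $U(\theta)$, $YS=TY$, $XT=SX$, and $\ker Y=\{0\}$. Furthermore: (i) if $\varphi$ is outer and $a\ne0$, then $X$ is a quasiaffinity; (ii) if $\varphi$ is outer and $\operatorname{clos}\,(\theta-1)\mathcal K_\beta=\mathcal K_{\theta\beta}$, then $Y$ is a quasiaffinity; (iii) if $\beta$ is not constant, then $T$ is expansive if and only if $2\operatorname{Re}(\overline a b)\le-1$; moreover (for every inner $\beta$), if $2\operatorname{Re}(\overline a b)\le-1$, then $T$ is expansive and $1/\varphi\in H^\infty$. -/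

import Mathlib

open MeasureTheory AddCircle InnerProductSpace
open scoped ENNReal ComplexConjugate

noncomputable section

namespace HardySpace

/-! ### The spaces `L²`, `H²`, `H^∞` on the unit circle

The unit circle is parametrised by `UnitAddCircle = ℝ / ℤ` through `t ↦ ζ = e^{2πit}`; this is the
function `fourier 1`. Normalised Lebesgue measure is `haarAddCircle`. Hardy classes consist of
boundary functions: those whose Fourier coefficients of negative index vanish. -/

/-- Normalised Lebesgue measure on the unit circle. -/
abbrev circleMeasure : Measure UnitAddCircle := haarAddCircle

/-- The space `L²` of the unit circle. -/
abbrev L2 : Type := Lp ℂ 2 circleMeasure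

theorem memLp_two {f : UnitAddCircle → ℂ} (hf : MemLp f ∞ circleMeasure) :
    MemLp f 2 circleMeasure :=
  hf.mono_exponent le_top

theorem memLp_fourier (n : ℤ) : MemLp (fun t : UnitAddCircle => fourier n t) ∞ circleMeasure := by
  refine memLp_top_of_bound (map_continuous (fourier n)).aestronglyMeasurable 1 ?_
  filter_upwards with t
  rw [fourier_apply, Circle.norm_coe]

/-- Multiplication by a bounded function, as an operator on `L²`. -/
def mulL2 (f : UnitAddCircle → ℂ) (hf : MemLp f ∞ circleMeasure) : L2 →L[ℂ] L2 :=
  (ContinuousLinearMap.mul ℂ ℂ).holderL circleMeasure ∞ 2 2 (hf.toLp f)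

theorem coeFn_mulL2 (f : UnitAddCircle → ℂ) (hf : MemLp f ∞ circleMeasure) (h : L2) :
    mulL2 f hf h =ᵐ[circleMeasure] fun t => f t * h t := by
  have h1 := (ContinuousLinearMap.mul ℂ ℂ).coeFn_holder (r := 2) (hf.toLp f) h
  filter_upwards [h1, hf.coeFn_toLp] with t h1 h2
  rw [mulL2, ContinuousLinearMap.holderL_apply_apply, h1, h2, ContinuousLinearMap.mul_apply']

theorem fourierCoeff_fourier_mul (f : UnitAddCircle → ℂ) (n k : ℤ) :
    fourierCoeff (fun t => f t * fourier k t) n = fourierCoeff f (n - k) := by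
  unfold fourierCoeff
  congr 1
  ext t
  rw [neg_sub, sub_eq_neg_add, fourier_add, smul_eq_mul, smul_eq_mul]
  ring

/-- If `f` is bounded, with Fourier coefficients vanishing below `p`, and `h` is in `L²`, with
Fourier coefficients vanishing below `0`, then those of the product `f h` vanish below `p`. -/
theorem fourierCoeff_mulL2_eq_zero {f : UnitAddCircle → ℂ} (hf : MemLp f ∞ circleMeasure) {p : ℤ}
    (hf' : ∀ n : ℤ, n < p → fourierCoeff f n = 0) {h : L2}
    (hh : ∀ n : ℤ, n < 0 → fourierCoeff h n = 0) {n : ℤ} (hn : n < p) :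
    fourierCoeff (mulL2 f hf h) n = 0 := by
  have key : HasSum (fun k : ℤ => (fourierCoeff h k) •
      (innerSL ℂ (fourierBasis n) (mulL2 f hf (fourierLp 2 k)))) (fourierCoeff (mulL2 f hf h) n) := by
    have := (hasSum_fourier_series_L2 h).mapL ((innerSL ℂ (fourierBasis n)) ∘L mulL2 f hf)
    rw [ContinuousLinearMap.comp_apply, innerSL_apply_apply, ← fourierBasis.repr_apply_apply,
      fourierBasis_repr] at this
    simpa using this
  refine key.unique ?_
  convert hasSum_zero with k
  rcases lt_or_ge k 0 with hk | hk
  · rw [hh k hk, zero_smul]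
  · rw [innerSL_apply_apply, ← fourierBasis.repr_apply_apply, fourierBasis_repr]
    have : fourierCoeff (mulL2 f hf (fourierLp 2 k)) = fourierCoeff (fun t => f t * fourier k t) := by
      apply fourierCoeff_congr_ae
      filter_upwards [coeFn_mulL2 f hf (fourierLp 2 k), coeFn_fourierLp (T := 1) 2 k] with t h1 h2
      rw [h1, h2]
    rw [this, fourierCoeff_fourier_mul, hf' _ (by omega), smul_zero]

/-- The Hardy space `H²`, as a subspace of `L²`. -/
def hardyTwo : Submodule ℂ L2 where
  carrier := {h | ∀ n : ℤ, n < 0 → fourierCoeff h n = 0}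
  zero_mem' := fun n _ => by rw [← fourierBasis_repr, map_zero]; rfl
  add_mem' := fun {f g} hf hg n hn => by
    have h1 := hf n hn
    have h2 := hg n hn
    rw [← fourierBasis_repr] at h1 h2 ⊢
    rw [map_add, lp.coeFn_add, Pi.add_apply, h1, h2, add_zero]
  smul_mem' := fun c f hf n hn => by
    have h1 := hf n hn
    rw [← fourierBasis_repr] at h1 ⊢
    rw [map_smul, lp.coeFn_smul, Pi.smul_apply, h1, smul_zero]

theorem mem_hardyTwo {h : L2} : h ∈ hardyTwo ↔ ∀ n : ℤ, n < 0 → fourierCoeff h n = 0 := Iff.rfl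

theorem isClosed_hardyTwo : IsClosed (hardyTwo : Set L2) := by
  have : (hardyTwo : Set L2) = ⋂ n : ℤ, ⋂ _ : n < 0, {h | ⟪fourierBasis n, h⟫_ℂ = 0} := by
    ext h
    simp only [SetLike.mem_coe, mem_hardyTwo, Set.mem_iInter, Set.mem_ofPred_eq]
    refine forall₂_congr fun n _ => ?_
    rw [← fourierBasis.repr_apply_apply, fourierBasis_repr]
  rw [this]
  exact isClosed_iInter fun n => isClosed_iInter fun _ =>
    isClosed_eq (continuous_const.inner continuous_id) continuous_const

instance : CompleteSpace hardyTwo := isClosed_hardyTwo.completeSpace_coe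

/-- The Hardy space `H²` as a Hilbert space. -/
abbrev H2 : Type := hardyTwo

/-- The orthogonal projection `P₊` of `L²` onto `H²`. -/
def rieszProj : L2 →L[ℂ] H2 := hardyTwo.orthogonalProjectionOnto

/-- The algebra `H^∞`, consisting of (representatives of) boundary functions. -/
def hInfty : Subalgebra ℂ (UnitAddCircle → ℂ) where
  carrier := {f | MemLp f ∞ circleMeasure ∧ ∀ n : ℤ, n < 0 → fourierCoeff f n = 0}
  mul_mem' := fun {f g} hf hg => by
    refine ⟨hg.1.mul hf.1, fun n hn => ?_⟩
    have h1 : ⇑((memLp_two hg.1).toLp g) =ᵐ[circleMeasure] g := MemLp.coeFn_toLp _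
    rw [← fourierCoeff_mulL2_eq_zero hf.1 hf.2 (h := (memLp_two hg.1).toLp g)
      (fun k hk => by rw [fourierCoeff_congr_ae h1]; exact hg.2 k hk) hn]
    refine congrFun (fourierCoeff_congr_ae ?_) n
    filter_upwards [coeFn_mulL2 f hf.1 ((memLp_two hg.1).toLp g), h1] with t h2 h3
    rw [h2, h3, Pi.mul_apply]
  add_mem' := fun {f g} hf hg => by
    refine ⟨hf.1.add hg.1, fun n hn => ?_⟩
    rw [fourierCoeff.add (hf.1.integrable le_top) (hg.1.integrable le_top), Pi.add_apply,
      hf.2 n hn, hg.2 n hn, add_zero]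
  algebraMap_mem' := fun c => by
    refine ⟨memLp_const c, fun n hn => ?_⟩
    have h0 : (algebraMap ℂ (UnitAddCircle → ℂ) c) = c • fun t => fourier 0 t := by
      ext t
      simp
    rw [h0, fourierCoeff.const_smul, fourierCoeff_fourier, Pi.single_apply, if_neg hn.ne, smul_zero]

/-- The value `f(z) = ∑ f̂(n) zⁿ` at a point `z` of the open unit disc of the analytic function
with boundary function `f`. -/
def diskEval (f : hInfty) (z : ℂ) : ℂ := ∑' n : ℕ, fourierCoeff (f : UnitAddCircle → ℂ) n * z ^ n

theorem diskEval_zero (f : hInfty) :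
    diskEval f 0 = fourierCoeff (f : UnitAddCircle → ℂ) 0 := by
  rw [diskEval, tsum_eq_single 0 (fun n hn => by rw [zero_pow hn, mul_zero])]
  simp

/-- A function of `H^∞` as a vector of `H²`. -/
def toH2 (f : hInfty) : H2 :=
  ⟨(memLp_two f.2.1).toLp f, fun n hn => by
    rw [fourierCoeff_congr_ae (MemLp.coeFn_toLp _)]
    exact f.2.2 n hn⟩

/-- Multiplication by a function `f` of `H^∞`, as an operator on `H²`. -/
def mulH2 (f : hInfty) : H2 →L[ℂ] H2 :=
  ((mulL2 f f.2.1) ∘L hardyTwo.subtypeL).codRestrict hardyTwo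
    fun h => fun _ hn => fourierCoeff_mulL2_eq_zero f.2.1 f.2.2 h.2 hn

theorem coeFn_mulH2 (f : hInfty) (h : H2) :
    (mulH2 f h : L2) =ᵐ[circleMeasure] fun t => (f : UnitAddCircle → ℂ) t * (h : L2) t :=
  coeFn_mulL2 _ _ _

/-- The function `χ(ζ) = ζ`. -/
def chi : hInfty :=
  ⟨fun t => fourier 1 t, memLp_fourier 1, fun n hn => by
    rw [fourierCoeff_fourier, Pi.single_apply, if_neg (by omega)]⟩

/-- The simple unilateral shift `S`: multiplication by `χ` on `H²`. -/
def shift : H2 →L[ℂ] H2 := mulH2 chi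

/-- The vector `χ̄ f` of `L²`, for `f` in `H^∞`. -/
def chiBarMul (f : hInfty) : L2 := mulL2 (fun t => fourier (-1) t) (memLp_fourier (-1)) (toH2 f)

theorem coeFn_chiBarMul (f : hInfty) : chiBarMul f =ᵐ[circleMeasure]
    fun t => (f : UnitAddCircle → ℂ) t * fourier (-1) t := by
  filter_upwards [coeFn_mulL2 _ (memLp_fourier (-1)) (toH2 f),
    (memLp_two f.2.1).coeFn_toLp] with t h1 h2
  rw [chiBarMul, h1, toH2, h2, mul_comm]

theorem chiBarMul_mem {f : hInfty} (hf : diskEval f 0 = 0) : chiBarMul f ∈ hardyTwo := by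
  intro n hn
  rw [fourierCoeff_congr_ae (coeFn_chiBarMul f), fourierCoeff_fourier_mul]
  rcases (show n ≤ -1 by omega).lt_or_eq with h | h
  · exact f.2.2 _ (by omega)
  · rw [h, sub_self, ← diskEval_zero, hf]

/-! ### Inner and outer functions, model spaces -/

/-- Inner functions: functions in `H^∞` of modulus one almost everywhere on the circle
(unimodular constants are included). -/
structure InnerFunction where
  fn : hInfty
  norm_eq_one : ∀ᵐ t ∂circleMeasure, ‖(fn : UnitAddCircle → ℂ) t‖ = 1

/-- A function `f` of `H^∞` is outer if `log |f|` is integrable on the circle and, for some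
unimodular constant `c`,
`f(z) = c exp (∫ (ζ + z) / (ζ - z) log |f(ζ)| dm(ζ))` in the open unit disc. -/
def IsOuter (f : hInfty) : Prop :=
  Integrable (fun t => Real.log ‖(f : UnitAddCircle → ℂ) t‖) circleMeasure ∧
  ∃ c : ℂ, ‖c‖ = 1 ∧ ∀ z : ℂ, ‖z‖ < 1 →
    diskEval f z = c * Complex.exp (∫ t : UnitAddCircle,
      (fourier 1 t + z) / (fourier 1 t - z) * (Real.log ‖(f : UnitAddCircle → ℂ) t‖ : ℂ)
        ∂circleMeasure)

/-- The subspace `f H²`. -/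
def rangeH2 (f : hInfty) : Submodule ℂ H2 := (mulH2 f).range

/-- The model space `K_f = H² ⊖ f H²`. -/
def modelSpace (f : hInfty) : Submodule ℂ H2 := (rangeH2 f)ᗮ

theorem inner_mulH2_mulH2 (β : InnerFunction) (h k : H2) :
    ⟪mulH2 β.fn h, mulH2 β.fn k⟫_ℂ = ⟪h, k⟫_ℂ := by
  rw [Submodule.coe_inner, Submodule.coe_inner, L2.inner_def, L2.inner_def]
  refine integral_congr_ae ?_
  filter_upwards [coeFn_mulH2 β.fn h, coeFn_mulH2 β.fn k, β.norm_eq_one] with t h1 h2 h3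
  have h4 : (β.fn : UnitAddCircle → ℂ) t * conj ((β.fn : UnitAddCircle → ℂ) t) = 1 := by
    rw [Complex.mul_conj, Complex.normSq_eq_norm_sq, h3]
    simp
  simp only [h1, h2, RCLike.inner_apply, map_mul]
  linear_combination (conj ((h : L2) t) * (k : L2) t) * h4

/-- Multiplication by an inner function is an isometry of `H²`. -/
def mulIsometry (β : InnerFunction) : H2 →ₗᵢ[ℂ] H2 :=
  (mulH2 β.fn).toLinearMap.isometryOfInner (inner_mulH2_mulH2 β)

/-- The subspace `β M` of `H²`. -/
def mulSubmodule (β : InnerFunction) (M : Submodule ℂ H2) : Submodule ℂ H2 :=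
  M.map (mulH2 β.fn).toLinearMap

instance (f : hInfty) : CompleteSpace (modelSpace f) := by
  unfold modelSpace
  infer_instance

instance (β : InnerFunction) (M : Submodule ℂ H2) [CompleteSpace M] :
    CompleteSpace (mulSubmodule β M) :=
  completeSpace_coe_iff_isComplete.2
    ((mulIsometry β).isComplete_map_iff.2 (completeSpace_coe_iff_isComplete.1 inferInstance))

instance (β : InnerFunction) : CompleteSpace (rangeH2 β.fn) :=
  (mulIsometry β).isometry.isClosedEmbedding.isClosed_range.completeSpace_coe

/-! ### Operator-theoretic notions -/

section Operators

variable {E F : Type*} [NormedAddCommGroup E] [InnerProductSpace ℂ E]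
  [NormedAddCommGroup F] [InnerProductSpace ℂ F]

/-- `M` is a closed subspace that is invariant for `T`. -/
def InLat (T : E →L[ℂ] E) (M : Submodule ℂ E) : Prop :=
  IsClosed (M : Set E) ∧ ∀ x ∈ M, T x ∈ M

/-- The compression `P_M T|_M` of `T` to `M`. -/
def compression (T : E →L[ℂ] E) (M : Submodule ℂ E) [M.HasOrthogonalProjection] : M →L[ℂ] M :=
  M.orthogonalProjectionOnto ∘L T ∘L M.subtypeL

/-- Unitary equivalence of operators. -/
def UnitarilyEquivalent (A : E →L[ℂ] E) (B : F →L[ℂ] F) : Prop :=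
  ∃ V : E ≃ₗᵢ[ℂ] F, ∀ x, V (A x) = B (V x)

/-- A quasiaffinity: a bounded operator with zero kernel and dense range. -/
def IsQuasiaffinity (X : E →L[ℂ] F) : Prop := X.ker = ⊥ ∧ DenseRange X

/-- `T` is expansive. -/
def IsExpansive (T : E →L[ℂ] E) : Prop := ∀ x, ‖x‖ ≤ ‖T x‖

end Operators

/-! ### The operator `U(θ)` -/

theorem one_mem_modelSpace {θ : hInfty} (hθ : diskEval θ 0 = 0) : toH2 1 ∈ modelSpace θ := by
  rintro _ ⟨h, rfl⟩
  have h1 : fourierCoeff (mulL2 θ θ.2.1 h) 0 = 0 := by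
    refine fourierCoeff_mulL2_eq_zero θ.2.1 (p := 1) (fun n hn => ?_) h.2 one_pos
    rcases (show n ≤ 0 by omega).lt_or_eq with h' | rfl
    · exact θ.2.2 n h'
    · rw [← diskEval_zero, hθ]
  have h2 : ⟪toH2 1, mulH2 θ h⟫_ℂ = 0 := by
    rw [Submodule.coe_inner, L2.inner_def, ← h1, fourierCoeff]
    refine integral_congr_ae ?_
    filter_upwards [(memLp_two (1 : hInfty).2.1).coeFn_toLp] with t ht
    have h3 : (mulH2 θ h : L2) = mulL2 θ θ.2.1 h := rfl
    simp only [toH2, ht, RCLike.inner_apply, h3]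
    simp
  exact inner_eq_zero_symm.1 h2

theorem chiBarMul_mem_modelSpace (θ : InnerFunction) (hθ : diskEval θ.fn 0 = 0) :
    (⟨chiBarMul θ.fn, chiBarMul_mem hθ⟩ : H2) ∈ modelSpace θ.fn := by
  rintro _ ⟨h, rfl⟩
  refine inner_eq_zero_symm.1 ?_
  rw [Submodule.coe_inner, L2.inner_def, ← h.2 (-1) (by omega), fourierCoeff]
  refine integral_congr_ae ?_
  filter_upwards [coeFn_chiBarMul θ.fn, coeFn_mulH2 θ.fn h, θ.norm_eq_one] with t h1 h2 h3
  have h4 : (θ.fn : UnitAddCircle → ℂ) t * conj ((θ.fn : UnitAddCircle → ℂ) t) = 1 := by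
    rw [Complex.mul_conj, Complex.normSq_eq_norm_sq, h3]
    simp
  have h5 : conj (fourier (-1) t : ℂ) = fourier 1 t := by rw [fourier_neg, Complex.conj_conj]
  simp only [h1, RCLike.inner_apply, smul_eq_mul, map_mul, neg_neg, h5]
  erw [h2]
  linear_combination (fourier 1 t * (h : L2) t) * h4

/-- The operator `U(θ) = S(θ) + 1 ⊗ χ̄θ` on `K_θ`, where `S(θ)` is the compression of the shift to
`K_θ` and `(x ⊗ y) f = (f, y) x`. It is defined for inner `θ` with `θ(0) = 0`, so that `1` and
`χ̄θ` belong to `K_θ`. -/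
def clarkU (θ : InnerFunction) (hθ : diskEval θ.fn 0 = 0) :
    modelSpace θ.fn →L[ℂ] modelSpace θ.fn :=
  compression shift (modelSpace θ.fn) +
    rankOne ℂ (⟨toH2 1, one_mem_modelSpace hθ⟩ : modelSpace θ.fn)
      (⟨⟨chiBarMul θ.fn, chiBarMul_mem hθ⟩, chiBarMul_mem_modelSpace θ hθ⟩ : modelSpace θ.fn)

/-! ### The operators `T`, `X`, `Y` -/

/-- The function `φ = a + b (θ - 1)`. -/
def symbol (θ : InnerFunction) (a b : ℂ) : hInfty := algebraMap ℂ hInfty a + b • (θ.fn - 1)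

/-- `T = S + (1 + (a - 1) θ) β ⊗ β χ̄θ + b θ β ⊗ P₊ χ̄β`, with `(x ⊗ y) f = (f, y) x`. -/
def opT (θ β : InnerFunction) (hθ : diskEval θ.fn 0 = 0) (a b : ℂ) : H2 →L[ℂ] H2 :=
  shift +
    rankOne ℂ (toH2 ((1 + (a - 1) • θ.fn) * β.fn))
      (mulH2 β.fn ⟨chiBarMul θ.fn, chiBarMul_mem hθ⟩) +
    rankOne ℂ (toH2 (b • (θ.fn * β.fn))) (rieszProj (chiBarMul β.fn))

/-- The operator `X`, given on the orthogonal sum `H² = θβH² ⊕ βK_θ ⊕ K_β` by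
`X (θβh + βf + g) = (θ - 1)βh + aβf + φg`; see `opX_apply`. The vectors `h`, `f`, `g` are
recovered from `u = θβh + βf + g` through `h = (θ·)* (β·)* u`, `f = P_{K_θ} (β·)* u`,
`g = P_{K_β} u`. -/
def opX (θ β : InnerFunction) (a b : ℂ) : H2 →L[ℂ] H2 :=
  mulH2 ((θ.fn - 1) * β.fn) ∘L (mulH2 θ.fn).adjoint ∘L (mulH2 β.fn).adjoint +
    a • (mulH2 β.fn ∘L (modelSpace θ.fn).starProjection ∘L (mulH2 β.fn).adjoint) +
    mulH2 (symbol θ a b) ∘L (modelSpace β.fn).starProjection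

/-- The operator `Y`, given on the orthogonal sum `H² = βH² ⊕ K_β` by
`Y (βh + g) = θβφh + θ P_{βH²}(φg) + (θ - 1)g`; see `opY_apply`. The vectors `h`, `g` are
recovered from `u = βh + g` through `h = (β·)* u`, `g = P_{K_β} u`. -/
def opY (θ β : InnerFunction) (a b : ℂ) : H2 →L[ℂ] H2 :=
  mulH2 (θ.fn * β.fn * symbol θ a b) ∘L (mulH2 β.fn).adjoint +
    (mulH2 θ.fn ∘L (rangeH2 β.fn).starProjection ∘L mulH2 (symbol θ a b) + mulH2 (θ.fn - 1)) ∘L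
      (modelSpace β.fn).starProjection

theorem mulH2_mul (f g : hInfty) (h : H2) : mulH2 (f * g) h = mulH2 f (mulH2 g h) := by
  refine Subtype.ext (Lp.ext ?_)
  filter_upwards [coeFn_mulH2 (f * g) h, coeFn_mulH2 f (mulH2 g h), coeFn_mulH2 g h] with t h1 h2 h3
  rw [h1, h2, h3, MulMemClass.coe_mul, Pi.mul_apply, mul_assoc]

theorem adjoint_mulH2_mulH2 (β : InnerFunction) (h : H2) :
    (mulH2 β.fn).adjoint (mulH2 β.fn h) = h :=
  ext_inner_left ℂ fun k => by
    rw [ContinuousLinearMap.adjoint_inner_right, inner_mulH2_mulH2]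

theorem adjoint_mulH2_of_mem {f : hInfty} {g : H2} (hg : g ∈ modelSpace f) :
    (mulH2 f).adjoint g = 0 :=
  ext_inner_left ℂ fun k => by
    rw [ContinuousLinearMap.adjoint_inner_right, inner_zero_right]
    exact hg _ ⟨k, rfl⟩

theorem starProjection_mulH2 (f h : _) : (modelSpace f).starProjection (mulH2 f h) = 0 :=
  (Submodule.starProjection_apply_eq_zero_iff _).2
    (Submodule.le_orthogonal_orthogonal _ ⟨h, rfl⟩)

theorem opX_apply (θ β : InnerFunction) (a b : ℂ) (h f g : H2) (hf : f ∈ modelSpace θ.fn)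
    (hg : g ∈ modelSpace β.fn) :
    opX θ β a b (mulH2 (θ.fn * β.fn) h + mulH2 β.fn f + g) =
      mulH2 ((θ.fn - 1) * β.fn) h + a • mulH2 β.fn f + mulH2 (symbol θ a b) g := by
  have e : mulH2 (θ.fn * β.fn) h = mulH2 β.fn (mulH2 θ.fn h) := by rw [mul_comm, mulH2_mul]
  have h1 : (mulH2 β.fn).adjoint (mulH2 (θ.fn * β.fn) h + mulH2 β.fn f + g) =
      mulH2 θ.fn h + f := by
    rw [e, map_add, map_add, adjoint_mulH2_mulH2, adjoint_mulH2_mulH2, adjoint_mulH2_of_mem hg,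
      add_zero]
  have h2 : (modelSpace β.fn).starProjection (mulH2 (θ.fn * β.fn) h + mulH2 β.fn f + g) = g := by
    rw [e, map_add, map_add, starProjection_mulH2, starProjection_mulH2,
      Submodule.starProjection_eq_self_iff.2 hg, zero_add, zero_add]
  simp only [opX, add_apply, smul_apply,
    ContinuousLinearMap.comp_apply, h1, h2]
  rw [map_add, adjoint_mulH2_mulH2, adjoint_mulH2_of_mem hf, add_zero, map_add,
    starProjection_mulH2, Submodule.starProjection_eq_self_iff.2 hf, zero_add]

theorem opY_apply (θ β : InnerFunction) (a b : ℂ) (h g : H2) (hg : g ∈ modelSpace β.fn) :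
    opY θ β a b (mulH2 β.fn h + g) =
      mulH2 (θ.fn * β.fn * symbol θ a b) h +
        mulH2 θ.fn ((rangeH2 β.fn).starProjection (mulH2 (symbol θ a b) g)) +
        mulH2 (θ.fn - 1) g := by
  have h1 : (mulH2 β.fn).adjoint (mulH2 β.fn h + g) = h := by
    rw [map_add, adjoint_mulH2_mulH2, adjoint_mulH2_of_mem hg, add_zero]
  have h2 : (modelSpace β.fn).starProjection (mulH2 β.fn h + g) = g := by
    rw [map_add, starProjection_mulH2, Submodule.starProjection_eq_self_iff.2 hg, zero_add]
  simp only [opY, add_apply, ContinuousLinearMap.comp_apply, h1, h2, add_assoc]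

end HardySpace

end

open HardySpace

noncomputable section

namespace HardySpace

/-! Everything is read in the orthogonal sum H² = θβH² ⊕ βK_θ ⊕ K_β. The shift leaves K_θ and K_β
only along one vector each, θ and β; for u = θβh + βf + g let c = (χf, θ) and d = (χg, β) be the two
leakage coefficients. Then T sends the coordinates (h, f, g) to (χh + ac + bd, χf − cθ + c + d, χg −
dβ) (`opT_apply_add_add`). Invariance of the subspaces and the compression to βK_θ are visible in
this triangular form, and the intertwining relations become identities between the leakage terms.

Outerness enters only through |b| ≤ |a − b| (`norm_le_of_isOuter_symbol`): φ = (a − b) + bθ, and if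
|b| were larger, Jensen's formula would give log|b| as the mean of log|φ|, while an outer function
has mean log|φ(0)| = log|a − b|. Given the inequality, a relation between pg and qθg, or its adjoint
version, forces equality of norms; a projection then loses nothing, and what remains is an
eigenvector of multiplication by θ, impossible since θ(0) = 0 (`eq_zero_of_inner_smul_add`,
`eq_zero_of_smul_add_eq_mulH2`).

For expansivity, ‖Tu‖² − ‖u‖² is a Hermitian form in (c, d) with diagonal |a|², |b|² and
off-diagonal entry 1 + āb (`norm_sq_opT`, `norm_sq_mul_add_mul`). Its determinant is −1 − 2Re(āb),
so it is nonnegative exactly when 2Re(āb) ≤ −1; every pair (c, d) occurs once β is not constant. The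
same condition gives |b| < |a − b|, and a Neumann series inverts φ. -/

/-- The inner product of `L²`, preferred over the one that comes from `CStarModule`. -/
instance : Inner ℂ L2 := InnerProductSpace.toInner

/-- The inner product of `H²`, preferred over the one that comes from `CStarModule`. -/
instance : Inner ℂ H2 := InnerProductSpace.toInner

theorem H2.inner_smul_left (c : ℂ) (x y : H2) : ⟪c • x, y⟫_ℂ = conj c * ⟪x, y⟫_ℂ :=
  _root_.inner_smul_left x y c

theorem H2.inner_smul_right (c : ℂ) (x y : H2) : ⟪x, c • y⟫_ℂ = c * ⟪x, y⟫_ℂ :=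
  _root_.inner_smul_right x y c

/-! ### Fourier coefficients of products -/

theorem hasSum_fourierCoeff_mulL2 {f : UnitAddCircle → ℂ} (hf : MemLp f ∞ circleMeasure)
    (h : L2) (n : ℤ) :
    HasSum (fun k : ℤ => fourierCoeff h k * fourierCoeff f (n - k))
      (fourierCoeff (mulL2 f hf h) n) := by
  have key : HasSum (fun k : ℤ => (fourierCoeff h k) •
      (innerSL ℂ (fourierBasis n) (mulL2 f hf (fourierLp 2 k)))) (fourierCoeff (mulL2 f hf h) n) := by
    have := ContinuousLinearMap.hasSum ((innerSL ℂ (fourierBasis n : L2)) ∘L mulL2 f hf)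
      (hasSum_fourier_series_L2 h)
    rw [ContinuousLinearMap.comp_apply, innerSL_apply_apply, ← fourierBasis.repr_apply_apply,
      fourierBasis_repr] at this
    simpa using this
  convert key using 2 with k
  have : fourierCoeff (mulL2 f hf (fourierLp 2 k)) = fourierCoeff (fun t => f t * fourier k t) := by
    apply fourierCoeff_congr_ae
    filter_upwards [coeFn_mulL2 f hf (fourierLp 2 k), coeFn_fourierLp (T := 1) 2 k] with t h1 h2
    rw [h1, h2]
  rw [innerSL_apply_apply, ← fourierBasis.repr_apply_apply, fourierBasis_repr, smul_eq_mul, this,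
    fourierCoeff_fourier_mul]

theorem L2.eq_zero_of_fourierCoeff {h : L2} (hh : ∀ n : ℤ, fourierCoeff h n = 0) : h = 0 := by
  refine (map_eq_zero_iff fourierBasis.repr fourierBasis.repr.injective).1 (lp.ext ?_)
  ext n
  rw [fourierBasis_repr, hh n]
  rfl

theorem H2.eq_zero_of_fourierCoeff {h : H2} (hh : ∀ n : ℕ, fourierCoeff (h : L2) n = 0) :
    h = 0 := by
  refine Subtype.ext (L2.eq_zero_of_fourierCoeff fun n => ?_)
  rcases lt_or_ge n 0 with hn | hn
  · exact h.2 n hn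
  · lift n to ℕ using hn
    exact hh n

/-- If `θ(0) = 0`, then multiplication by `θ` has no nonzero eigenvalue. -/
theorem eq_zero_of_eq_smul_mulH2 {θ : hInfty} (hθ : diskEval θ 0 = 0) {c : ℂ} {v : H2}
    (hv : v = c • mulH2 θ v) : v = 0 := by
  have hθ' : ∀ n : ℤ, n ≤ 0 → fourierCoeff (θ : UnitAddCircle → ℂ) n = 0 := fun n hn => by
    rcases hn.lt_or_eq with h | rfl
    · exact θ.2.2 n h
    · rw [← diskEval_zero, hθ]
  refine H2.eq_zero_of_fourierCoeff fun n => ?_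
  induction n using Nat.strong_induction_on with
  | _ n ih =>
    -- The coefficients of θ start at index 1, so only those of v below n contribute, and they
    -- vanish by induction.
    have h1 : fourierCoeff (mulH2 θ v : L2) n = 0 := by
      refine (hasSum_fourierCoeff_mulL2 θ.2.1 v n).unique ?_
      convert hasSum_zero with k
      rcases lt_or_ge k n with hk | hk
      · rcases lt_or_ge k 0 with hk' | hk'
        · rw [v.2 k hk', zero_mul]
        · lift k to ℕ using hk'
          rw [ih k (by exact_mod_cast hk), zero_mul]
      · rw [hθ' _ (by omega), mul_zero]
    have h2 : (v : L2) = c • (mulH2 θ v : L2) := by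
      conv_lhs => rw [hv]
      rfl
    rw [← fourierBasis_repr] at h1 ⊢
    rw [h2, map_smul, lp.coeFn_smul, Pi.smul_apply, h1, smul_zero]

/-- Multiplication by a nonzero function of `H^∞` is injective on `H²`. -/
theorem eq_zero_of_mulH2_eq_zero {f : hInfty}
    (hf : ¬ (f : UnitAddCircle → ℂ) =ᵐ[circleMeasure] 0) {h : H2} (hh : mulH2 f h = 0) :
    h = 0 := by
  have hf0 : ∃ n : ℕ, fourierCoeff (f : UnitAddCircle → ℂ) n ≠ 0 := by
    by_contra! H
    have h0 : toH2 f = 0 := H2.eq_zero_of_fourierCoeff fun n => by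
      rw [← H n]
      exact congrFun (fourierCoeff_congr_ae (memLp_two f.2.1).coeFn_toLp) _
    refine hf ?_
    have h1 : (toH2 f : L2) = 0 := by rw [h0]; rfl
    have h2 := Lp.coeFn_zero ℂ 2 circleMeasure
    rw [← h1] at h2
    exact (memLp_two f.2.1).coeFn_toLp.symm.trans h2
  classical
  set p := Nat.find hf0 with hp
  have hp1 : fourierCoeff (f : UnitAddCircle → ℂ) p ≠ 0 := Nat.find_spec hf0
  have hp2 : ∀ n : ℤ, n < p → fourierCoeff (f : UnitAddCircle → ℂ) n = 0 := fun n hn => by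
    rcases lt_or_ge n 0 with hn' | hn'
    · exact f.2.2 n hn'
    · lift n to ℕ using hn'
      exact not_not.1 (Nat.find_min hf0 (by exact_mod_cast hn))
  refine H2.eq_zero_of_fourierCoeff fun n => ?_
  induction n using Nat.strong_induction_on with
  | _ n ih =>
    -- With p the lowest index in f, and h known to vanish below n, the only surviving term at index
    -- p + n is the product of the coefficients of f at p and of h at n.
    have h1 := hasSum_fourierCoeff_mulL2 f.2.1 h (p + n)
    have h2 : fourierCoeff (mulL2 f f.2.1 h) (p + n) = 0 := by
      have : mulL2 f f.2.1 h = (mulH2 f h : L2) := rfl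
      rw [this, hh, ← fourierBasis_repr, Submodule.coe_zero, map_zero]
      rfl
    have h3 := hasSum_single (f := fun k : ℤ => fourierCoeff (h : L2) k *
      fourierCoeff (f : UnitAddCircle → ℂ) (p + n - k)) n fun k hk => by
        rcases hk.lt_or_gt with hk | hk
        · rcases lt_or_ge k 0 with hk' | hk'
          · rw [h.2 k hk', zero_mul]
          · lift k to ℕ using hk'
            rw [ih k (by exact_mod_cast hk), zero_mul]
        · rw [hp2 _ (by omega), mul_zero]
    have h4 := h3.unique h1
    rw [h2, add_sub_cancel_right] at h4
    exact (mul_eq_zero.1 h4).resolve_right hp1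

/-! ### The multiplication operators -/

theorem mulH2_add_fn (f g : hInfty) (h : H2) : mulH2 (f + g) h = mulH2 f h + mulH2 g h := by
  refine Subtype.ext (Lp.ext ?_)
  filter_upwards [coeFn_mulH2 (f + g) h, coeFn_mulH2 f h, coeFn_mulH2 g h,
    Lp.coeFn_add (mulH2 f h : L2) (mulH2 g h)] with t h1 h2 h3 h4
  rw [h1, Submodule.coe_add, h4, Pi.add_apply, h2, h3, AddMemClass.coe_add, Pi.add_apply, add_mul]

theorem mulH2_smul_fn (c : ℂ) (f : hInfty) (h : H2) : mulH2 (c • f) h = c • mulH2 f h := by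
  refine Subtype.ext (Lp.ext ?_)
  filter_upwards [coeFn_mulH2 (c • f) h, coeFn_mulH2 f h,
    Lp.coeFn_smul c (mulH2 f h : L2)] with t h1 h2 h3
  rw [h1, Submodule.coe_smul, h3, Pi.smul_apply, h2, SetLike.val_smul, Pi.smul_apply, smul_eq_mul,
    smul_eq_mul, mul_assoc]

theorem mulH2_one_fn (h : H2) : mulH2 1 h = h := by
  refine Subtype.ext (Lp.ext ?_)
  filter_upwards [coeFn_mulH2 1 h] with t h1
  rw [h1, OneMemClass.coe_one, Pi.one_apply, one_mul]

theorem mulH2_sub_one (f : hInfty) (h : H2) : mulH2 (f - 1) h = mulH2 f h - h := by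
  rw [eq_sub_iff_add_eq]
  nth_rw 2 [← mulH2_one_fn h]
  rw [← mulH2_add_fn, sub_add_cancel]

theorem mulH2_comm (f g : hInfty) (h : H2) : mulH2 f (mulH2 g h) = mulH2 g (mulH2 f h) := by
  rw [← mulH2_mul, mul_comm, mulH2_mul]

theorem mulH2_symbol (θ : InnerFunction) (a b : ℂ) (h : H2) :
    mulH2 (symbol θ a b) h = (a - b) • h + b • mulH2 θ.fn h := by
  rw [symbol, Algebra.algebraMap_eq_smul_one, mulH2_add_fn, mulH2_smul_fn, mulH2_smul_fn,
    mulH2_one_fn, mulH2_sub_one]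
  module

theorem toH2_eq_mulH2_one (f : hInfty) : toH2 f = mulH2 f (toH2 1) := by
  refine Subtype.ext (Lp.ext ?_)
  filter_upwards [coeFn_mulH2 f (toH2 1), (memLp_two f.2.1).coeFn_toLp,
    (memLp_two (1 : hInfty).2.1).coeFn_toLp] with t h1 h2 h3
  rw [h1]
  simp only [toH2, h2, h3]
  simp

theorem toH2_mul (f g : hInfty) : toH2 (f * g) = mulH2 f (toH2 g) := by
  rw [toH2_eq_mulH2_one, mulH2_mul, ← toH2_eq_mulH2_one]

/-- The function `χ`, as an inner function. -/
def chiInner : InnerFunction where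
  fn := chi
  norm_eq_one := Filter.Eventually.of_forall fun t => by
    change ‖(fourier 1 t : ℂ)‖ = 1
    rw [fourier_apply, Circle.norm_coe]

/-! ### The shift, the constants and division by χ. -/

theorem inner_shift_shift (h k : H2) : ⟪shift h, shift k⟫_ℂ = ⟪h, k⟫_ℂ :=
  inner_mulH2_mulH2 chiInner h k

theorem norm_mulH2 (β : InnerFunction) (h : H2) : ‖mulH2 β.fn h‖ = ‖h‖ :=
  (mulIsometry β).norm_map h

theorem norm_shift (h : H2) : ‖shift h‖ = ‖h‖ := norm_mulH2 chiInner h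

theorem mulH2_injective (β : InnerFunction) {h k : H2} (e : mulH2 β.fn h = mulH2 β.fn k) :
    h = k :=
  (mulIsometry β).injective e

theorem shift_mulH2 (f : hInfty) (h : H2) : shift (mulH2 f h) = mulH2 f (shift h) :=
  mulH2_comm _ _ _

/-- A function of `H^∞` vanishing at the origin maps `H²` into the orthogonal complement of `1`. -/
theorem inner_one_mulH2 {f : hInfty} (hf : diskEval f 0 = 0) (h : H2) :
    ⟪toH2 1, mulH2 f h⟫_ℂ = 0 :=
  Submodule.inner_left_of_mem_orthogonal (K := rangeH2 f) ⟨h, rfl⟩ (one_mem_modelSpace hf)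

theorem diskEval_chi_zero : diskEval chi 0 = 0 := by
  rw [diskEval_zero]
  change fourierCoeff (fun t : UnitAddCircle => (fourier 1 t : ℂ)) 0 = 0
  rw [fourierCoeff_fourier, Pi.single_apply, if_neg (by omega)]

theorem inner_one_shift (h : H2) : ⟪toH2 1, shift h⟫_ℂ = 0 := inner_one_mulH2 diskEval_chi_zero h

theorem inner_shift_one (h : H2) : ⟪shift h, toH2 1⟫_ℂ = 0 :=
  inner_eq_zero_symm.1 (inner_one_shift h)

theorem fourierCoeff_toH2_one (n : ℤ) :
    fourierCoeff (toH2 1 : L2) n = if n = 0 then 1 else 0 := by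
  have : fourierCoeff (toH2 1 : L2) =
      fourierCoeff (fun t : UnitAddCircle => (fourier 0 t : ℂ)) := by
    refine fourierCoeff_congr_ae ?_
    filter_upwards [(memLp_two (1 : hInfty).2.1).coeFn_toLp] with t ht
    simp only [toH2, ht]
    simp
  rw [this, fourierCoeff_fourier, Pi.single_apply]

theorem inner_toH2_one (h : H2) : ⟪toH2 1, h⟫_ℂ = fourierCoeff (h : L2) 0 := by
  have h1 : (toH2 1 : L2) = fourierBasis 0 := by
    refine sub_eq_zero.1 (L2.eq_zero_of_fourierCoeff fun n => ?_)
    rw [← fourierBasis_repr, map_sub, lp.coeFn_sub, Pi.sub_apply, fourierBasis_repr,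
      fourierCoeff_toH2_one, fourierBasis.repr_self, lp.single_apply, Pi.single_apply, sub_self]
  rw [Submodule.coe_inner, h1, ← fourierBasis.repr_apply_apply, fourierBasis_repr]

theorem inner_toH2_one_self : ⟪toH2 1, toH2 1⟫_ℂ = 1 := by
  rw [inner_toH2_one, fourierCoeff_toH2_one, if_pos rfl]

/-- A vector of `H²` is the sum of its constant term and a multiple of `χ`. -/
theorem exists_eq_shift_add (x : H2) : ∃ k : H2, x = shift k + ⟪toH2 1, x⟫_ℂ • toH2 1 := by
  set y : H2 := x - ⟪toH2 1, x⟫_ℂ • toH2 1 with hy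
  have hy0 : fourierCoeff (y : L2) 0 = 0 := by
    rw [← inner_toH2_one, hy, inner_sub_right, H2.inner_smul_right, inner_toH2_one_self, mul_one,
      sub_self]
  have hk : mulL2 (fun t => fourier (-1) t) (memLp_fourier (-1)) y ∈ hardyTwo := by
    intro n hn
    have : fourierCoeff (mulL2 (fun t => fourier (-1) t) (memLp_fourier (-1)) y) =
        fourierCoeff (fun t => (y : L2) t * fourier (-1) t) := by
      refine fourierCoeff_congr_ae ?_
      filter_upwards [coeFn_mulL2 _ (memLp_fourier (-1)) (y : L2)] with t ht
      rw [ht, mul_comm]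
    rw [this, fourierCoeff_fourier_mul]
    rcases (show n ≤ -1 by omega).lt_or_eq with h | h
    · exact y.2 _ (by omega)
    · rw [h, sub_self, hy0]
  refine ⟨⟨_, hk⟩, ?_⟩
  rw [← sub_eq_iff_eq_add, ← hy]
  refine Subtype.ext (Lp.ext ?_)
  filter_upwards [coeFn_mulL2 _ (memLp_fourier (-1)) (y : L2),
    coeFn_mulH2 chi ⟨_, hk⟩] with t h1 h2
  have h3 : (fourier 1 t : ℂ) * fourier (-1) t = 1 := by
    rw [← fourier_add]
    simp
  rw [shift, h2, h1]
  change _ = fourier 1 t * _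
  linear_combination (-(y : L2) t) * h3

/-- A vector orthogonal to `χ H²` is constant. -/
theorem eq_smul_one_of_inner_shift {x : H2} (hx : ∀ k, ⟪shift k, x⟫_ℂ = 0) :
    x = ⟪toH2 1, x⟫_ℂ • toH2 1 := by
  obtain ⟨k, hk⟩ := exists_eq_shift_add x
  have h1 : ⟪shift k, shift k⟫_ℂ = 0 := by
    have := hx k
    rw [hk, inner_add_right, H2.inner_smul_right, inner_shift_one, mul_zero, add_zero] at this
    exact this
  rw [inner_self_eq_zero] at h1
  rw [h1, zero_add] at hk
  exact hk

/-- The projection is invisible against u ∈ H², and χ̄ crosses to the other side as χ. This turns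
the functional in the last term of T into a leakage coefficient of χu. -/
theorem inner_rieszProj_chiBarMul (f : hInfty) (u : H2) :
    ⟪rieszProj (chiBarMul f), u⟫_ℂ = ⟪toH2 f, shift u⟫_ℂ := by
  rw [rieszProj, Submodule.inner_orthogonalProjectionOnto_eq_of_mem_right, Submodule.coe_inner,
    L2.inner_def, L2.inner_def]
  refine integral_congr_ae ?_
  filter_upwards [coeFn_chiBarMul f, (memLp_two f.2.1).coeFn_toLp, coeFn_mulH2 chi u]
    with t h1 h2 h3
  have h5 : conj (fourier (-1) t : ℂ) = fourier 1 t := by rw [fourier_neg, Complex.conj_conj]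
  have h6 : (chi : UnitAddCircle → ℂ) t = fourier 1 t := rfl
  simp only [shift, toH2, h1, h2, h3, h6, RCLike.inner_apply, map_mul, h5]
  ring

theorem inner_chiBarMul {f : hInfty} (hf : diskEval f 0 = 0) (u : H2) :
    ⟪(⟨chiBarMul f, chiBarMul_mem hf⟩ : H2), u⟫_ℂ = ⟪toH2 f, shift u⟫_ℂ := by
  rw [← inner_rieszProj_chiBarMul, rieszProj,
    Submodule.inner_orthogonalProjectionOnto_eq_of_mem_right, Submodule.coe_inner]

theorem shift_chiBarMul {f : hInfty} (hf : diskEval f 0 = 0) :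
    shift ⟨chiBarMul f, chiBarMul_mem hf⟩ = toH2 f := by
  refine Subtype.ext (Lp.ext ?_)
  filter_upwards [coeFn_chiBarMul f, (memLp_two f.2.1).coeFn_toLp,
    coeFn_mulH2 chi ⟨chiBarMul f, chiBarMul_mem hf⟩] with t h1 h2 h3
  have h4 : (fourier 1 t : ℂ) * fourier (-1) t = 1 := by
    rw [← fourier_add]
    simp
  have h6 : (chi : UnitAddCircle → ℂ) t = fourier 1 t := rfl
  rw [shift, h3, h6, h1]
  simp only [toH2, h2]
  linear_combination (f : UnitAddCircle → ℂ) t * h4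

/-! ### Model spaces and the projections onto them -/

theorem mem_modelSpace_iff_adjoint {f : hInfty} {g : H2} :
    g ∈ modelSpace f ↔ (mulH2 f).adjoint g = 0 := by
  rw [modelSpace, rangeH2, ContinuousLinearMap.orthogonal_range, LinearMap.mem_ker,
    ContinuousLinearMap.coe_coe]

theorem inner_mulH2_of_mem_modelSpace {f : hInfty} {g : H2} (hg : g ∈ modelSpace f) (h : H2) :
    ⟪mulH2 f h, g⟫_ℂ = 0 :=
  hg _ ⟨h, rfl⟩

theorem inner_mem_modelSpace_mulH2 {f : hInfty} {g : H2} (hg : g ∈ modelSpace f) (h : H2) :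
    ⟪g, mulH2 f h⟫_ℂ = 0 :=
  inner_eq_zero_symm.1 (hg _ ⟨h, rfl⟩)

/-- Multiplication by β is an isometry, so its product with its adjoint is the projection onto βH².
-/
theorem sub_mulH2_adjoint_mem (β : InnerFunction) (u : H2) :
    u - mulH2 β.fn ((mulH2 β.fn).adjoint u) ∈ modelSpace β.fn := by
  rw [mem_modelSpace_iff_adjoint, map_sub, adjoint_mulH2_mulH2, sub_self]

theorem starProjection_rangeH2 (β : InnerFunction) (u : H2) :
    (rangeH2 β.fn).starProjection u = mulH2 β.fn ((mulH2 β.fn).adjoint u) := by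
  refine Submodule.eq_starProjection_of_mem_orthogonal ⟨_, rfl⟩ (sub_mulH2_adjoint_mem β u)

theorem exists_eq_mulH2_add (β : InnerFunction) (u : H2) :
    ∃ h g : H2, g ∈ modelSpace β.fn ∧ u = mulH2 β.fn h + g :=
  ⟨_, _, sub_mulH2_adjoint_mem β u, (add_sub_cancel _ _).symm⟩

theorem exists_eq_mulH2_add_add (θ β : InnerFunction) (u : H2) :
    ∃ h f g : H2, f ∈ modelSpace θ.fn ∧ g ∈ modelSpace β.fn ∧
      u = mulH2 (θ.fn * β.fn) h + mulH2 β.fn f + g := by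
  obtain ⟨k, g, hg, rfl⟩ := exists_eq_mulH2_add β u
  obtain ⟨h, f, hf, rfl⟩ := exists_eq_mulH2_add θ k
  exact ⟨h, f, g, hf, hg, by rw [map_add, mul_comm, mulH2_mul]⟩

theorem norm_sq_mulH2_add (β : InnerFunction) {h g : H2} (hg : g ∈ modelSpace β.fn) :
    ‖mulH2 β.fn h + g‖ ^ 2 = ‖h‖ ^ 2 + ‖g‖ ^ 2 := by
  have := norm_add_sq_eq_norm_sq_add_norm_sq_of_inner_eq_zero (𝕜 := ℂ) (mulH2 β.fn h) g
    (inner_mulH2_of_mem_modelSpace hg h)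
  rw [norm_mulH2] at this
  rw [sq, sq, sq, this]

/-- The compression of the shift to `K_β`. -/
theorem shift_sub_mem_modelSpace (β : InnerFunction) {g : H2} (hg : g ∈ modelSpace β.fn) :
    shift g - ⟪mulH2 β.fn (toH2 1), shift g⟫_ℂ • mulH2 β.fn (toH2 1) ∈ modelSpace β.fn := by
  set x := (mulH2 β.fn).adjoint (shift g) with hx
  -- Since g is orthogonal to βH², χg is orthogonal to χβH²; hence x is orthogonal to χH² and the
  -- leak into βH² is one-dimensional.
  have h1 : x = ⟪toH2 1, x⟫_ℂ • toH2 1 := by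
    refine eq_smul_one_of_inner_shift fun k => ?_
    rw [hx, ContinuousLinearMap.adjoint_inner_right, ← shift_mulH2, inner_shift_shift]
    exact inner_mulH2_of_mem_modelSpace hg k
  have h2 : ⟪toH2 1, x⟫_ℂ = ⟪mulH2 β.fn (toH2 1), shift g⟫_ℂ := by
    rw [hx, ContinuousLinearMap.adjoint_inner_right]
  rw [← h2, ← map_smul, ← h1, hx]
  exact sub_mulH2_adjoint_mem β _

theorem norm_toH2_one : ‖toH2 1‖ = 1 := by
  rw [norm_eq_sqrt_re_inner (𝕜 := ℂ), inner_toH2_one_self, RCLike.one_re, Real.sqrt_one]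

theorem norm_sq_shift_sub (β : InnerFunction) {g : H2} (hg : g ∈ modelSpace β.fn) :
    ‖shift g - ⟪mulH2 β.fn (toH2 1), shift g⟫_ℂ • mulH2 β.fn (toH2 1)‖ ^ 2 =
      ‖g‖ ^ 2 - ‖⟪mulH2 β.fn (toH2 1), shift g⟫_ℂ‖ ^ 2 := by
  set c := ⟪mulH2 β.fn (toH2 1), shift g⟫_ℂ
  have h1 := norm_sq_mulH2_add β (h := c • toH2 1) (shift_sub_mem_modelSpace β hg)
  rw [map_smul, add_sub_cancel, norm_shift, norm_smul, norm_toH2_one, mul_one] at h1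
  linarith

/-! ### The operator `T` -/

theorem opT_apply (θ β : InnerFunction) (hθ : diskEval θ.fn 0 = 0) (a b : ℂ) (u : H2) :
    opT θ β hθ a b u = shift u +
      ⟪mulH2 β.fn (mulH2 θ.fn (toH2 1)), shift u⟫_ℂ •
        (mulH2 β.fn (toH2 1) + (a - 1) • mulH2 β.fn (mulH2 θ.fn (toH2 1))) +
      ⟪mulH2 β.fn (toH2 1), shift u⟫_ℂ • b • mulH2 β.fn (mulH2 θ.fn (toH2 1)) := by
  have h1 : ⟪mulH2 β.fn ⟨chiBarMul θ.fn, chiBarMul_mem hθ⟩, u⟫_ℂ =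
      ⟪mulH2 β.fn (mulH2 θ.fn (toH2 1)), shift u⟫_ℂ := by
    rw [← toH2_eq_mulH2_one, ← shift_chiBarMul hθ, ← shift_mulH2, inner_shift_shift]
  have h2 : toH2 ((1 + (a - 1) • θ.fn) * β.fn) =
      mulH2 β.fn (toH2 1) + (a - 1) • mulH2 β.fn (mulH2 θ.fn (toH2 1)) := by
    rw [toH2_eq_mulH2_one, mulH2_mul, mulH2_add_fn, mulH2_one_fn, mulH2_smul_fn, mulH2_comm θ.fn]
  have h3 : toH2 (b • (θ.fn * β.fn)) = b • mulH2 β.fn (mulH2 θ.fn (toH2 1)) := by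
    rw [toH2_eq_mulH2_one, mulH2_smul_fn, mulH2_mul, mulH2_comm θ.fn]
  have h4 := inner_rieszProj_chiBarMul β.fn u
  rw [toH2_eq_mulH2_one] at h4
  simp only [opT, add_apply, rankOne_apply]
  rw [← h1, ← h2, ← h3, ← h4]

/-- The action of `T` on the orthogonal sum `H² = θβH² ⊕ βK_θ ⊕ K_β`. -/
theorem opT_apply_add_add (θ β : InnerFunction) (hθ : diskEval θ.fn 0 = 0) (a b : ℂ) (h f g : H2)
    (hg : g ∈ modelSpace β.fn) :
    opT θ β hθ a b (mulH2 (θ.fn * β.fn) h + mulH2 β.fn f + g) =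
      mulH2 (θ.fn * β.fn) (shift h + (⟪mulH2 θ.fn (toH2 1), shift f⟫_ℂ * a +
        ⟪mulH2 β.fn (toH2 1), shift g⟫_ℂ * b) • toH2 1) +
      mulH2 β.fn (shift f - ⟪mulH2 θ.fn (toH2 1), shift f⟫_ℂ • mulH2 θ.fn (toH2 1) +
        (⟪mulH2 θ.fn (toH2 1), shift f⟫_ℂ + ⟪mulH2 β.fn (toH2 1), shift g⟫_ℂ) • toH2 1) +
      (shift g - ⟪mulH2 β.fn (toH2 1), shift g⟫_ℂ • mulH2 β.fn (toH2 1)) := by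
  have e : ∀ x, mulH2 (θ.fn * β.fn) x = mulH2 β.fn (mulH2 θ.fn x) := fun x => by
    rw [mul_comm, mulH2_mul]
  -- As θ(0) = 0, χ̄θ lies in H², so (χg, βθ) = (g, βχ̄θ) = 0.
  have h1 : ⟪mulH2 β.fn (mulH2 θ.fn (toH2 1)), shift g⟫_ℂ = 0 := by
    rw [← toH2_eq_mulH2_one, ← shift_chiBarMul hθ, ← shift_mulH2, inner_shift_shift]
    exact inner_mulH2_of_mem_modelSpace hg _
  have h2 : ⟪mulH2 β.fn (mulH2 θ.fn (toH2 1)),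
      shift (mulH2 (θ.fn * β.fn) h + mulH2 β.fn f + g)⟫_ℂ = ⟪mulH2 θ.fn (toH2 1), shift f⟫_ℂ := by
    rw [map_add, map_add, inner_add_right, inner_add_right, h1, e, shift_mulH2, shift_mulH2,
      shift_mulH2, inner_mulH2_mulH2, inner_mulH2_mulH2, inner_mulH2_mulH2, inner_one_shift,
      zero_add, add_zero]
  have h3 : ⟪mulH2 β.fn (toH2 1), shift (mulH2 (θ.fn * β.fn) h + mulH2 β.fn f + g)⟫_ℂ =
      ⟪mulH2 β.fn (toH2 1), shift g⟫_ℂ := by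
    rw [map_add, map_add, inner_add_right, inner_add_right, e, shift_mulH2, inner_mulH2_mulH2,
      inner_one_shift, shift_mulH2, inner_mulH2_mulH2, inner_one_shift, zero_add, zero_add]
  rw [opT_apply, h2, h3]
  simp only [map_add, map_sub, map_smul, e, shift_mulH2]
  module

theorem inLat_rangeH2_mul (θ β : InnerFunction) (hθ : diskEval θ.fn 0 = 0) (a b : ℂ) :
    InLat (opT θ β hθ a b) (rangeH2 (θ.fn * β.fn)) := by
  constructor
  · have e : (rangeH2 (θ.fn * β.fn) : Set H2) =
        Set.range fun x => mulIsometry β (mulIsometry θ x) := by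
      ext y
      refine exists_congr fun x => ?_
      change mulH2 (θ.fn * β.fn) x = y ↔ mulH2 β.fn (mulH2 θ.fn x) = y
      rw [mul_comm, mulH2_mul]
    rw [e]
    exact ((mulIsometry β).isometry.comp (mulIsometry θ).isometry).isClosedEmbedding.isClosed_range
  · rintro _ ⟨h, rfl⟩
    have := opT_apply_add_add θ β hθ a b h 0 0 (zero_mem _)
    simp only [map_zero, add_zero, inner_zero_right, zero_smul, sub_zero, zero_mul] at this
    exact ⟨shift h, this.symm⟩

theorem inLat_rangeH2 (θ β : InnerFunction) (hθ : diskEval θ.fn 0 = 0) (a b : ℂ) :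
    InLat (opT θ β hθ a b) (rangeH2 β.fn) := by
  refine ⟨(mulIsometry β).isometry.isClosedEmbedding.isClosed_range, ?_⟩
  rintro _ ⟨f, rfl⟩
  have := opT_apply_add_add θ β hθ a b 0 f 0 (zero_mem _)
  simp only [map_zero, add_zero, zero_add, inner_zero_right, zero_smul, sub_zero, zero_mul] at this
  change opT θ β hθ a b (mulH2 β.fn f) ∈ _
  rw [this, mul_comm, mulH2_mul, ← map_add]
  exact ⟨_, rfl⟩

/-- Multiplication by `β`, as a unitary operator from `M` onto `βM`. -/
def mulSubmoduleEquiv (β : InnerFunction) (M : Submodule ℂ H2) : M ≃ₗᵢ[ℂ] mulSubmodule β M where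
  toLinearEquiv := Submodule.equivMapOfInjective _ (mulIsometry β).injective M
  norm_map' x := norm_mulH2 β x

theorem clarkU_apply (θ : InnerFunction) (hθ : diskEval θ.fn 0 = 0) (f : modelSpace θ.fn) :
    (clarkU θ hθ f : H2) = shift f - ⟪mulH2 θ.fn (toH2 1), shift f⟫_ℂ • mulH2 θ.fn (toH2 1) +
      ⟪mulH2 θ.fn (toH2 1), shift f⟫_ℂ • toH2 1 := by
  have h1 : (modelSpace θ.fn).starProjection (shift f) =
      shift f - ⟪mulH2 θ.fn (toH2 1), shift f⟫_ℂ • mulH2 θ.fn (toH2 1) := by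
    refine Submodule.eq_starProjection_of_mem_orthogonal (shift_sub_mem_modelSpace θ f.2) ?_
    rw [sub_sub_cancel, ← map_smul]
    exact Submodule.le_orthogonal_orthogonal (rangeH2 θ.fn) ⟨_, rfl⟩
  have h2 := inner_chiBarMul hθ (f : H2)
  rw [toH2_eq_mulH2_one] at h2
  rw [← h1, ← h2]
  rfl

/-- T(βf) is βU(θ)f plus a multiple of θβ, which is orthogonal to βK_θ; the compression discards it,
and a with it. -/
theorem unitarilyEquivalent_compression (θ β : InnerFunction) (hθ : diskEval θ.fn 0 = 0)
    (a b : ℂ) :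
    UnitarilyEquivalent (E := mulSubmodule β (modelSpace θ.fn)) (F := modelSpace θ.fn)
      (compression (opT θ β hθ a b) (mulSubmodule β (modelSpace θ.fn))) (clarkU θ hθ) := by
  refine ⟨(mulSubmoduleEquiv β (modelSpace θ.fn)).symm, fun x => ?_⟩
  obtain ⟨f, rfl⟩ := (mulSubmoduleEquiv β (modelSpace θ.fn)).surjective x
  rw [LinearIsometryEquiv.symm_apply_apply, LinearIsometryEquiv.symm_apply_eq]
  refine Subtype.ext ?_
  change (mulSubmodule β (modelSpace θ.fn)).starProjection (opT θ β hθ a b (mulH2 β.fn f)) =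
    mulH2 β.fn (clarkU θ hθ f)
  refine Submodule.eq_starProjection_of_mem_orthogonal ⟨_, (clarkU θ hθ f).2, rfl⟩ ?_
  have h1 := opT_apply_add_add θ β hθ a b 0 f 0 (zero_mem _)
  simp only [map_zero, add_zero, zero_add, inner_zero_right, zero_smul, sub_zero, zero_mul] at h1
  rw [h1, clarkU_apply, add_sub_cancel_right, mul_comm θ.fn, mulH2_mul]
  rintro _ ⟨g, hg, rfl⟩
  exact (inner_mulH2_mulH2 β _ _).trans (inner_mem_modelSpace_mulH2 hg _)

theorem mulH2_sub_one_mul (θ β : InnerFunction) (h : H2) :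
    mulH2 ((θ.fn - 1) * β.fn) h = mulH2 β.fn (mulH2 θ.fn h - h) := by
  rw [mul_comm, mulH2_mul, mulH2_sub_one]

/-! ### The intertwining relations -/

/-- Apart from χXu, the leakage terms in XTu are (ac + bd)(θ − 1)β, aβ(c + d − cθ) and −dφβ. Their
sum is zero precisely because φ = a + b(θ − 1). -/
theorem opX_comp_opT (θ β : InnerFunction) (hθ : diskEval θ.fn 0 = 0) (a b : ℂ) :
    opX θ β a b ∘L opT θ β hθ a b = shift ∘L opX θ β a b := by
  ext1 u
  obtain ⟨h, f, g, hf, hg, rfl⟩ := exists_eq_mulH2_add_add θ β u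
  rw [ContinuousLinearMap.comp_apply, ContinuousLinearMap.comp_apply,
    opT_apply_add_add θ β hθ a b h f g hg,
    opX_apply θ β a b _ _ _ (add_mem (shift_sub_mem_modelSpace θ hf)
      (Submodule.smul_mem _ _ (one_mem_modelSpace hθ))) (shift_sub_mem_modelSpace β hg),
    opX_apply θ β a b h f g hf hg]
  simp only [mulH2_sub_one_mul, mulH2_symbol, map_add, map_sub, map_smul, shift_mulH2,
    mulH2_comm θ.fn β.fn]
  module

theorem opY_comp_shift (θ β : InnerFunction) (hθ : diskEval θ.fn 0 = 0) (a b : ℂ) :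
    opY θ β a b ∘L shift = opT θ β hθ a b ∘L opY θ β a b := by
  ext1 u
  obtain ⟨h, g, hg, rfl⟩ := exists_eq_mulH2_add β u
  rw [ContinuousLinearMap.comp_apply, ContinuousLinearMap.comp_apply]
  set M := mulH2 θ.fn with hM
  set N := mulH2 β.fn with hN
  set e := toH2 1 with he
  set d := ⟪N e, shift g⟫_ℂ with hd
  set d' := ⟪N e, shift (M g)⟫_ℂ with hd'
  set k := N.adjoint (mulH2 (symbol θ a b) g) with hk
  have hs : shift (N h + g) = N (shift h + d • e) + (shift g - d • N e) := by
    rw [map_add, map_add, map_smul, hN, shift_mulH2]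
    abel
  have e1 : ∀ x, mulH2 (θ.fn * β.fn * symbol θ a b) x = (a - b) • N (M x) + b • N (M (M x)) :=
    fun x => by
      rw [mul_assoc, mulH2_mul, mulH2_mul, mulH2_symbol, mulH2_comm]
      simp only [map_add, map_smul, hM, hN]
  -- Split φg into βk and its part in K_β. After the shift, that part leaks into βH² with
  -- coefficient (χφg, β) = (a − b)d + bd', where d' is the coefficient (χθg, β).
  have k1 : N.adjoint (mulH2 (symbol θ a b) (shift g - d • N e)) =
      shift k + ((a - b) * d + b * d') • e - d • mulH2 (symbol θ a b) e := by
    have h1 : mulH2 (symbol θ a b) (shift g - d • N e) =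
        shift (mulH2 (symbol θ a b) g) - N (d • mulH2 (symbol θ a b) e) := by
      rw [map_sub, map_smul, map_smul, shift_mulH2, mulH2_comm]
    have h2 := shift_sub_mem_modelSpace β (sub_mulH2_adjoint_mem β (mulH2 (symbol θ a b) g))
    rw [mem_modelSpace_iff_adjoint, map_sub, map_sub, map_sub, map_smul,
      shift_mulH2 β.fn, adjoint_mulH2_mulH2, adjoint_mulH2_mulH2, inner_sub_right,
      inner_mulH2_mulH2, inner_one_shift, sub_zero] at h2
    have h3 : ⟪N e, shift (mulH2 (symbol θ a b) g)⟫_ℂ = (a - b) * d + b * d' := by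
      rw [mulH2_symbol, map_add, map_smul, map_smul, inner_add_right, H2.inner_smul_right,
        H2.inner_smul_right]
    rw [← hN, ← hk, ← he, h3] at h2
    rw [h1, map_sub, adjoint_mulH2_mulH2, ← sub_eq_zero, ← h2]
    module
  rw [hs, opY_apply θ β a b _ _ (shift_sub_mem_modelSpace β hg), opY_apply θ β a b h g hg,
    starProjection_rangeH2, starProjection_rangeH2, k1, ← hk, e1, e1, mulH2_sub_one, mulH2_sub_one]
  set y := (a - b) • N (M h) + b • N (M (M h)) + M (N k) + (M g - g) with hy
  have i1 : ∀ x, ⟪N (M e), shift (N (M x))⟫_ℂ = 0 := fun x => by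
    rw [shift_mulH2, inner_mulH2_mulH2, shift_mulH2, inner_mulH2_mulH2, inner_one_shift]
  have i2 : ∀ x, ⟪N e, shift (N x)⟫_ℂ = 0 := fun x => by
    rw [shift_mulH2, inner_mulH2_mulH2, inner_one_shift]
  have i3 : ⟪N (M e), shift (M g)⟫_ℂ = d := by
    rw [mulH2_comm β.fn θ.fn, shift_mulH2, inner_mulH2_mulH2]
  have i4 : ⟪N (M e), shift g⟫_ℂ = 0 := by
    rw [he, hM, ← toH2_eq_mulH2_one, ← shift_chiBarMul hθ, hN, ← shift_mulH2, inner_shift_shift]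
    exact inner_mulH2_of_mem_modelSpace hg _
  -- Here y is Yu. The two functionals in T take the values d and d' − d at y, which determines the
  -- finite-rank part of TYu.
  have j1 : ⟪N (M e), shift y⟫_ℂ = d := by
    rw [hy, hM, hN, mulH2_comm θ.fn β.fn k, ← hM, ← hN]
    simp only [map_add, map_sub, map_smul, inner_add_right, inner_sub_right, H2.inner_smul_right,
      i1, i3, i4]
    ring
  have j2 : ⟪N e, shift y⟫_ℂ = d' - d := by
    rw [hy, hM, hN, mulH2_comm θ.fn β.fn k, ← hM, ← hN]
    simp only [map_add, map_sub, map_smul, inner_add_right, inner_sub_right, H2.inner_smul_right,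
      i2]
    rw [← hd, ← hd']
    ring
  rw [opT_apply, j1, j2, hy]
  simp only [hM, hN, mulH2_symbol, map_add, map_sub, map_smul, shift_mulH2, mulH2_comm θ.fn β.fn]
  module

/-! ### Kernels and ranges -/

/-- Yu = 0 says g = θv with v = β(φh + k) + g. The adjoint of multiplication by θ preserves K_β, so
v ∈ K_β and φh + k = 0. Then g = θg, whence g = 0, k = 0 and φh = 0. -/
theorem ker_opY (θ β : InnerFunction) (hθ : diskEval θ.fn 0 = 0) (a b : ℂ)
    (hφ : ¬ (symbol θ a b : UnitAddCircle → ℂ) =ᵐ[circleMeasure] 0) :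
    (opY θ β a b).ker = ⊥ := by
  refine (Submodule.eq_bot_iff _).2 fun u hu => ?_
  obtain ⟨h, g, hg, rfl⟩ := exists_eq_mulH2_add β u
  rw [LinearMap.mem_ker, ContinuousLinearMap.coe_coe, opY_apply θ β a b h g hg,
    starProjection_rangeH2, mul_assoc, mulH2_mul, mulH2_mul, mulH2_sub_one] at hu
  set k := (mulH2 β.fn).adjoint (mulH2 (symbol θ a b) g)
  set w := mulH2 (symbol θ a b) h
  have h1 : g = mulH2 θ.fn (mulH2 β.fn (w + k) + g) := by
    rw [map_add, map_add, map_add, ← sub_eq_zero, ← neg_eq_zero, ← hu]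
    abel
  set v := mulH2 β.fn (w + k) + g with hv
  have h2 : (mulH2 β.fn).adjoint v = 0 := by
    refine ext_inner_left ℂ fun x => ?_
    rw [ContinuousLinearMap.adjoint_inner_right, inner_zero_right, ← inner_mulH2_mulH2 θ, ← h1,
      mulH2_comm]
    exact inner_mulH2_of_mem_modelSpace hg _
  have h3 : w + k = 0 := by
    rw [← h2, hv, map_add, adjoint_mulH2_mulH2, adjoint_mulH2_of_mem hg, add_zero]
  rw [h3, map_zero, zero_add] at hv
  have h4 : g = 0 := eq_zero_of_eq_smul_mulH2 hθ (c := 1) (by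
    rw [one_smul]
    exact h1.trans (congrArg _ hv))
  have h5 : k = 0 := by simp only [k, h4, map_zero]
  rw [h5, add_zero] at h3
  rw [eq_zero_of_mulH2_eq_zero hφ h3, h4, map_zero, add_zero]

/-- If `|q| ≤ |p|` and `p ≠ 0`, then `p + q θ` has dense range on `H²`. -/
theorem eq_zero_of_inner_smul_add {θ : InnerFunction} (hθ : diskEval θ.fn 0 = 0) {p q : ℂ}
    (hpq : ‖q‖ ≤ ‖p‖) (hp : p ≠ 0) {v : H2} (hv : ∀ h, ⟪p • h + q • mulH2 θ.fn h, v⟫_ℂ = 0) :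
    v = 0 := by
  set x := (mulH2 θ.fn).adjoint v with hx
  have h1 : conj p • v = -(conj q • x) := by
    rw [eq_neg_iff_add_eq_zero]
    refine ext_inner_left ℂ fun h => ?_
    rw [inner_add_right, H2.inner_smul_right, H2.inner_smul_right, inner_zero_right, ← hv h,
      inner_add_left, H2.inner_smul_left, H2.inner_smul_left, hx,
      ContinuousLinearMap.adjoint_inner_right]
  have h2 : ‖p‖ * ‖v‖ = ‖q‖ * ‖x‖ := by
    have := congrArg norm h1
    rwa [norm_neg, norm_smul, norm_smul, RCLike.norm_conj, RCLike.norm_conj] at this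
  have h3 : ‖v‖ ≤ ‖x‖ := by
    refine le_of_mul_le_mul_left ?_ (norm_pos_iff.2 hp)
    rw [h2]
    gcongr
  have h4 := norm_sq_mulH2_add θ (h := x) (sub_mulH2_adjoint_mem θ v)
  rw [← hx, add_sub_cancel] at h4
  -- The vector θx is the projection of v onto θH² and is no shorter than v, so it equals v.
  have h5 : v - mulH2 θ.fn x = 0 := by
    rw [← norm_eq_zero, ← sq_eq_zero_iff]
    nlinarith [norm_nonneg v, sq_nonneg ‖v - mulH2 θ.fn x‖]
  rw [sub_eq_zero] at h5
  have h6 : conj p ≠ 0 := (map_ne_zero _).2 hp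
  rcases eq_or_ne q 0 with rfl | hq
  · rw [map_zero, zero_smul, neg_zero] at h1
    exact (smul_eq_zero.1 h1).resolve_left h6
  · have h7 : conj q ≠ 0 := (map_ne_zero _).2 hq
    refine eq_zero_of_eq_smul_mulH2 hθ (c := -(conj p / conj q)) ?_
    have h8 := congrArg (mulH2 θ.fn) h1
    rw [map_neg, map_smul, map_smul, ← h5] at h8
    rw [neg_smul, div_eq_inv_mul, mul_smul, h8, smul_neg, neg_neg, inv_smul_smul₀ h7]

/-- If `|q| ≤ |p|` and `p ≠ 0`, then the only vector of `K_β` that `p + q θ` maps into `β H²` is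
zero. -/
theorem eq_zero_of_smul_add_eq_mulH2 {θ β : InnerFunction} (hθ : diskEval θ.fn 0 = 0) {p q : ℂ}
    (hpq : ‖q‖ ≤ ‖p‖) (hp : p ≠ 0) {g w : H2} (hg : g ∈ modelSpace β.fn)
    (hw : p • g + q • mulH2 θ.fn g = mulH2 β.fn w) : g = 0 := by
  set x := (mulH2 β.fn).adjoint (mulH2 θ.fn g) with hx
  have hr := sub_mulH2_adjoint_mem β (mulH2 θ.fn g)
  rw [← hx] at hr
  set r := mulH2 θ.fn g - mulH2 β.fn x with hr'
  have e1 : mulH2 θ.fn g = mulH2 β.fn x + r := (add_sub_cancel _ _).symm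
  have hwx : w = q • x := by
    have := congrArg (mulH2 β.fn).adjoint hw
    rw [map_add, map_smul, map_smul, adjoint_mulH2_mulH2, adjoint_mulH2_of_mem hg, smul_zero,
      zero_add] at this
    exact this.symm
  have h1 : p • g = -(q • r) := by
    rw [eq_neg_iff_add_eq_zero, hr', smul_sub, ← map_smul (mulH2 β.fn), ← hwx, ← hw]
    abel
  have h2 : ‖p‖ * ‖g‖ = ‖q‖ * ‖r‖ := by
    have := congrArg norm h1
    rwa [norm_neg, norm_smul, norm_smul] at this
  have h3 : ‖g‖ ≤ ‖r‖ := by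
    refine le_of_mul_le_mul_left ?_ (norm_pos_iff.2 hp)
    rw [h2]
    gcongr
  have h4 := norm_sq_mulH2_add β (h := x) hr
  rw [← e1, norm_mulH2] at h4
  -- βx and r are the orthogonal parts of θg, and ‖r‖ ≥ ‖g‖ = ‖θg‖ leaves no room for βx.
  have h5 : x = 0 := by
    rw [← norm_eq_zero, ← sq_eq_zero_iff]
    nlinarith [norm_nonneg g, sq_nonneg ‖x‖]
  rw [hwx, h5, smul_zero, map_zero] at hw
  rcases eq_or_ne q 0 with rfl | hq
  · rw [zero_smul, add_zero] at hw
    exact (smul_eq_zero.1 hw).resolve_left hp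
  · refine eq_zero_of_eq_smul_mulH2 hθ (c := -(q / p)) ?_
    rw [neg_smul, div_eq_inv_mul, mul_smul, ← smul_neg, ← eq_neg_of_add_eq_zero_left hw,
      inv_smul_smul₀ hp]

theorem denseRange_of_inner_eq_zero {A : H2 →L[ℂ] H2} (hA : ∀ v, (∀ u, ⟪A u, v⟫_ℂ = 0) → v = 0) :
    DenseRange A := by
  have h1 : A.range.topologicalClosure = ⊤ := by
    rw [Submodule.topologicalClosure_eq_top_iff, Submodule.eq_bot_iff]
    exact fun v hv => hA v fun u => hv _ ⟨u, rfl⟩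
  exact (Submodule.dense_iff_topologicalClosure_eq_top).2 h1

theorem isQuasiaffinity_opX (θ β : InnerFunction) (hθ : diskEval θ.fn 0 = 0) {a b : ℂ}
    (hab : ‖b‖ ≤ ‖a - b‖) (hab' : a - b ≠ 0) (ha : a ≠ 0) : IsQuasiaffinity (opX θ β a b) := by
  constructor
  · refine (Submodule.eq_bot_iff _).2 fun u hu => ?_
    obtain ⟨h, f, g, hf, hg, rfl⟩ := exists_eq_mulH2_add_add θ β u
    rw [LinearMap.mem_ker, ContinuousLinearMap.coe_coe, opX_apply θ β a b h f g hf hg,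
      mulH2_sub_one_mul, ← map_smul, ← map_add, mulH2_symbol] at hu
    have hg0 : g = 0 := eq_zero_of_smul_add_eq_mulH2 hθ hab hab' hg
      (w := -(mulH2 θ.fn h - h + a • f)) (by rw [map_neg]; exact eq_neg_of_add_eq_zero_right hu)
    rw [hg0, map_zero, smul_zero, smul_zero, add_zero, add_zero,
      ← map_zero (mulH2 β.fn)] at hu
    have h1 := mulH2_injective β hu
    have h2 := congrArg (mulH2 θ.fn).adjoint h1
    rw [map_add, map_sub, map_smul, adjoint_mulH2_mulH2, adjoint_mulH2_of_mem hf, smul_zero,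
      add_zero, map_zero, sub_eq_zero] at h2
    -- Applying the adjoint of θ removed f and made h a fixed vector of that adjoint, so h is
    -- orthogonal to (1 − θ)H².
    have hh0 : h = 0 := by
      refine eq_zero_of_inner_smul_add hθ (p := 1) (q := -1) (by simp) one_ne_zero fun k => ?_
      rw [inner_add_left, H2.inner_smul_left, H2.inner_smul_left,
        ← ContinuousLinearMap.adjoint_inner_right, ← h2]
      simp
    rw [hh0, map_zero, sub_zero, zero_add] at h1
    rw [hh0, hg0, (smul_eq_zero.1 h1).resolve_left ha, map_zero, map_zero, add_zero, add_zero]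
  · refine denseRange_of_inner_eq_zero fun v hv => ?_
    -- The vectors θβk are mapped to β(θ − 1)k, and (θ − 1)H² is dense.
    have h1 : v ∈ modelSpace β.fn := by
      rw [mem_modelSpace_iff_adjoint]
      refine eq_zero_of_inner_smul_add hθ (p := -1) (q := 1) (by simp) (by simp) fun k => ?_
      have := hv (mulH2 (θ.fn * β.fn) k + mulH2 β.fn 0 + 0)
      rw [opX_apply θ β a b k 0 0 (zero_mem _) (zero_mem _), map_zero, map_zero, smul_zero,
        add_zero, add_zero, mulH2_sub_one_mul] at this
      rw [ContinuousLinearMap.adjoint_inner_right, ← this]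
      congr 2
      module
    -- v is orthogonal to φK_β by assumption, and to φβH² because v ∈ K_β; so it is orthogonal to
    -- the dense subspace φH².
    refine eq_zero_of_inner_smul_add hθ hab hab' fun u => ?_
    obtain ⟨h, g, hg, rfl⟩ := exists_eq_mulH2_add β u
    have h2 := hv (mulH2 (θ.fn * β.fn) 0 + mulH2 β.fn 0 + g)
    rw [opX_apply θ β a b 0 0 g (zero_mem _) hg, map_zero, map_zero, smul_zero, zero_add,
      zero_add] at h2
    rw [← mulH2_symbol, map_add, inner_add_left, h2, mulH2_comm, add_zero]
    exact inner_mulH2_of_mem_modelSpace h1 _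

/-- A vector v orthogonal to the range is orthogonal to θβφH², hence lies in K_θβ because φH² is
dense. It then does not see the θβH² part of Yg, so it is orthogonal to (θ − 1)K_β, whose closure
contains v. -/
theorem denseRange_opY (θ β : InnerFunction) (hθ : diskEval θ.fn 0 = 0) {a b : ℂ}
    (hab : ‖b‖ ≤ ‖a - b‖) (hab' : a - b ≠ 0)
    (hc : ((modelSpace β.fn).map (mulH2 (θ.fn - 1)).toLinearMap).topologicalClosure =
      modelSpace (θ.fn * β.fn)) : DenseRange (opY θ β a b) := by
  refine denseRange_of_inner_eq_zero fun v hv => ?_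
  have h1 : (mulH2 (θ.fn * β.fn)).adjoint v = 0 := by
    refine eq_zero_of_inner_smul_add hθ hab hab' fun k => ?_
    have := hv (mulH2 β.fn k + 0)
    rw [opY_apply θ β a b k 0 (zero_mem _)] at this
    simp only [map_zero, add_zero] at this
    rwa [ContinuousLinearMap.adjoint_inner_right, ← mulH2_symbol, ← mulH2_mul]
  have h2 : v ∈ ((modelSpace β.fn).map (mulH2 (θ.fn - 1)).toLinearMap)ᗮ := by
    rintro _ ⟨g, hg, rfl⟩
    have := hv (mulH2 β.fn 0 + g)
    rw [opY_apply θ β a b 0 g hg, map_zero, zero_add, starProjection_rangeH2, ← mulH2_mul,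
      inner_add_left, ← ContinuousLinearMap.adjoint_inner_right, h1, inner_zero_right,
      zero_add] at this
    exact this
  rw [← Submodule.orthogonal_closure, hc] at h2
  exact inner_self_eq_zero.1 (h2 v (mem_modelSpace_iff_adjoint.2 h1))

/-! ### Expansivity -/

/-- The constants are orthogonal to χh and to χf − cθ. Compression loses |c|² and |d|², the
constants bring |ac + bd|² and |c + d|², and 2Re(c̄d) is what survives of the last. -/
theorem norm_sq_opT (θ β : InnerFunction) (hθ : diskEval θ.fn 0 = 0) (a b : ℂ) {h f g : H2}
    (hf : f ∈ modelSpace θ.fn) (hg : g ∈ modelSpace β.fn) :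
    ‖opT θ β hθ a b (mulH2 (θ.fn * β.fn) h + mulH2 β.fn f + g)‖ ^ 2 =
      ‖mulH2 (θ.fn * β.fn) h + mulH2 β.fn f + g‖ ^ 2 +
      (‖⟪mulH2 θ.fn (toH2 1), shift f⟫_ℂ * a + ⟪mulH2 β.fn (toH2 1), shift g⟫_ℂ * b‖ ^ 2 +
        2 * (conj ⟪mulH2 θ.fn (toH2 1), shift f⟫_ℂ * ⟪mulH2 β.fn (toH2 1), shift g⟫_ℂ).re) := by
  have nn : ∀ h f g : H2, f ∈ modelSpace θ.fn → g ∈ modelSpace β.fn →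
      ‖mulH2 (θ.fn * β.fn) h + mulH2 β.fn f + g‖ ^ 2 = ‖h‖ ^ 2 + ‖f‖ ^ 2 + ‖g‖ ^ 2 := by
    intro h f g hf hg
    rw [mul_comm, mulH2_mul, ← map_add, norm_sq_mulH2_add β hg, norm_sq_mulH2_add θ hf]
  have n1 : ∀ (x : H2) (c : ℂ), ⟪x, toH2 1⟫_ℂ = 0 →
      ‖x + c • toH2 1‖ ^ 2 = ‖x‖ ^ 2 + ‖c‖ ^ 2 := by
    intro x c hx
    have := norm_add_sq_eq_norm_sq_add_norm_sq_of_inner_eq_zero (𝕜 := ℂ) x (c • toH2 1)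
      (by rw [H2.inner_smul_right, hx, mul_zero])
    rw [norm_smul, norm_toH2_one, mul_one] at this
    rw [sq, sq, sq, this]
  have ho := one_mem_modelSpace hθ
  rw [opT_apply_add_add θ β hθ a b h f g hg, nn _ _ _ (add_mem (shift_sub_mem_modelSpace θ hf)
    (Submodule.smul_mem _ _ ho)) (shift_sub_mem_modelSpace β hg), nn h f g hf hg,
    n1 _ _ (inner_shift_one h), n1 _ _ ?_, norm_sq_shift_sub θ hf, norm_sq_shift_sub β hg,
    norm_shift]
  · have h1 : ∀ c d : ℂ, ‖c + d‖ ^ 2 = ‖c‖ ^ 2 + ‖d‖ ^ 2 + 2 * (conj c * d).re := fun c d => by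
      simp only [← Complex.normSq_eq_norm_sq, Complex.normSq_apply, Complex.add_re, Complex.add_im,
        Complex.mul_re, Complex.conj_re, Complex.conj_im]
      ring
    rw [h1 ⟪mulH2 θ.fn _, _⟫_ℂ]
    ring
  · rw [inner_sub_left, inner_shift_one, H2.inner_smul_left, inner_mulH2_of_mem_modelSpace ho,
      mul_zero, sub_zero]

/-! ### The condition for expansivity -/

theorem norm_sq_mul_add_mul (a b c d : ℂ) :
    ‖c * a + d * b‖ ^ 2 + 2 * (conj c * d).re =
      (‖a‖ * ‖c‖) ^ 2 + (‖b‖ * ‖d‖) ^ 2 + 2 * (conj c * d * (1 + conj a * b)).re := by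
  simp only [mul_pow, ← Complex.normSq_eq_norm_sq, Complex.normSq_apply, Complex.add_re,
    Complex.add_im, Complex.mul_re, Complex.mul_im, Complex.conj_re, Complex.conj_im,
    Complex.one_re, Complex.one_im]
  ring

theorem norm_sq_one_add (a b : ℂ) :
    ‖1 + conj a * b‖ ^ 2 = 1 + 2 * (conj a * b).re + (‖a‖ * ‖b‖) ^ 2 := by
  simp only [mul_pow, ← Complex.normSq_eq_norm_sq, Complex.normSq_apply, Complex.add_re,
    Complex.add_im, Complex.mul_re, Complex.mul_im, Complex.conj_re, Complex.conj_im,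
    Complex.one_re, Complex.one_im]
  ring

/-- The hypothesis is |1 + āb| ≤ |a||b|, so the cross term is dominated and the form is at least
(|a||c| − |b||d|)². -/
theorem form_nonneg {a b : ℂ} (h : 2 * (conj a * b).re ≤ -1) (c d : ℂ) :
    0 ≤ ‖c * a + d * b‖ ^ 2 + 2 * (conj c * d).re := by
  have h1 : ‖1 + conj a * b‖ ≤ ‖a‖ * ‖b‖ := by
    refine le_of_sq_le_sq ?_ (by positivity)
    rw [norm_sq_one_add]
    linarith
  have h2 : -(‖c‖ * ‖d‖ * (‖a‖ * ‖b‖)) ≤ (conj c * d * (1 + conj a * b)).re := by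
    refine le_trans ?_ (neg_le_of_abs_le (Complex.abs_re_le_norm _))
    rw [norm_mul, norm_mul, RCLike.norm_conj]
    gcongr
  rw [norm_sq_mul_add_mul]
  nlinarith [sq_nonneg (‖a‖ * ‖c‖ - ‖b‖ * ‖d‖)]

theorem le_of_form_nonneg {a b : ℂ}
    (h : ∀ c d : ℂ, 0 ≤ ‖c * a + d * b‖ ^ 2 + 2 * (conj c * d).re) :
    2 * (conj a * b).re ≤ -1 := by
  set w := 1 + conj a * b with hw
  -- Choosing c = −sw, d = 1 makes the cross term real and negative for s > 0.
  have h1 : ∀ s : ℝ, 0 ≤ ‖a‖ ^ 2 * ‖w‖ ^ 2 * s ^ 2 + ‖b‖ ^ 2 - 2 * s * ‖w‖ ^ 2 := fun s => by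
    have := h (-(s * w)) 1
    rw [norm_sq_mul_add_mul, ← hw] at this
    have e : (conj (-(s * w)) * 1 * w).re = -(s * ‖w‖ ^ 2) := by
      rw [← Complex.normSq_eq_norm_sq, Complex.normSq_apply]
      simp
      ring
    rw [e, norm_neg, norm_mul, Complex.norm_real, norm_one, mul_one, mul_pow, mul_pow,
      Real.norm_eq_abs, sq_abs] at this
    linarith
  rcases eq_or_ne a 0 with rfl | ha
  -- For a = 0, w = 1 and the form is |b|² − 2s, negative for this s.
  · have := h1 (‖b‖ ^ 2 + 1)
    simp only [hw, map_zero, zero_mul, add_zero, norm_one, norm_zero] at this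
    nlinarith [sq_nonneg ‖b‖]
  · have ha' : 0 < ‖a‖ ^ 2 := by positivity
    -- This s minimises the quadratic; the minimum is the determinant divided by |a|².
    have h2 := h1 (‖a‖ ^ 2)⁻¹
    have h3 : 0 ≤ ‖a‖ ^ 2 * (‖a‖ ^ 2 * ‖w‖ ^ 2 * (‖a‖ ^ 2)⁻¹ ^ 2 + ‖b‖ ^ 2 -
        2 * (‖a‖ ^ 2)⁻¹ * ‖w‖ ^ 2) := by positivity
    have h4 : ‖a‖ ^ 2 * (‖a‖ ^ 2 * ‖w‖ ^ 2 * (‖a‖ ^ 2)⁻¹ ^ 2 + ‖b‖ ^ 2 -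
        2 * (‖a‖ ^ 2)⁻¹ * ‖w‖ ^ 2) = (‖a‖ * ‖b‖) ^ 2 - ‖w‖ ^ 2 := by
      field_simp
      ring
    rw [h4, hw, norm_sq_one_add] at h3
    linarith

theorem isExpansive_opT (θ β : InnerFunction) (hθ : diskEval θ.fn 0 = 0) {a b : ℂ}
    (h : 2 * (conj a * b).re ≤ -1) : IsExpansive (opT θ β hθ a b) := by
  intro u
  obtain ⟨k, f, g, hf, hg, rfl⟩ := exists_eq_mulH2_add_add θ β u
  refine le_of_sq_le_sq ?_ (norm_nonneg _)
  rw [norm_sq_opT θ β hθ a b hf hg]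
  exact le_add_of_nonneg_right (form_nonneg h _ _)

/-- The witness is the backward shift k of β, from β = χk + β(0): it lies in K_β and has coefficient
(χk, β) = ‖k‖², zero only for constant β. -/
theorem exists_mem_modelSpace_inner_ne_zero {β : InnerFunction}
    (hβ : ¬ ∃ c : ℂ, (β.fn : UnitAddCircle → ℂ) =ᵐ[circleMeasure] fun _ => c) :
    ∃ g ∈ modelSpace β.fn, ⟪mulH2 β.fn (toH2 1), shift g⟫_ℂ ≠ 0 := by
  obtain ⟨k, hk⟩ := exists_eq_shift_add (mulH2 β.fn (toH2 1))
  set c := ⟪toH2 1, mulH2 β.fn (toH2 1)⟫_ℂ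
  refine ⟨k, ?_, ?_⟩
  · rintro _ ⟨x, rfl⟩
    change ⟪mulH2 β.fn x, k⟫_ℂ = 0
    rw [← inner_shift_shift, eq_sub_of_add_eq hk.symm, inner_sub_right, H2.inner_smul_right,
      inner_shift_one, shift_mulH2, inner_mulH2_mulH2, inner_shift_one, mul_zero, sub_zero]
  · rw [hk, inner_add_left, H2.inner_smul_left, inner_one_shift, mul_zero, add_zero,
      inner_shift_shift]
    intro h0
    rw [inner_self_eq_zero] at h0
    rw [h0, map_zero, zero_add, ← toH2_eq_mulH2_one] at hk
    refine hβ ⟨c, ?_⟩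
    have h1 : (toH2 β.fn : L2) = c • (toH2 1 : L2) := by rw [hk]; rfl
    filter_upwards [(memLp_two β.fn.2.1).coeFn_toLp, (memLp_two (1 : hInfty).2.1).coeFn_toLp,
      Lp.coeFn_smul c (toH2 1 : L2)] with t h2 h3 h4
    rw [← h1] at h4
    simp only [toH2] at h4
    rw [← h2, h4, Pi.smul_apply, h3]
    simp

theorem isExpansive_opT_iff (θ : InnerFunction) {β : InnerFunction} (hθ : diskEval θ.fn 0 = 0)
    (hβ : ¬ ∃ c : ℂ, (β.fn : UnitAddCircle → ℂ) =ᵐ[circleMeasure] fun _ => c) (a b : ℂ) :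
    IsExpansive (opT θ β hθ a b) ↔ 2 * (conj a * b).re ≤ -1 := by
  refine ⟨fun h => le_of_form_nonneg fun c d => ?_, isExpansive_opT θ β hθ⟩
  obtain ⟨g, hg, hg'⟩ := exists_mem_modelSpace_inner_ne_zero hβ
  -- χ̄θ has leakage coefficient 1, so scaling it and g prescribes c and d independently.
  set e : H2 := ⟨chiBarMul θ.fn, chiBarMul_mem hθ⟩ with he
  have he' : e ∈ modelSpace θ.fn := chiBarMul_mem_modelSpace θ hθ
  have h1 : ⟪mulH2 θ.fn (toH2 1), shift (c • e)⟫_ℂ = c := by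
    rw [map_smul, H2.inner_smul_right, he, shift_chiBarMul hθ, toH2_eq_mulH2_one θ.fn,
      inner_mulH2_mulH2, inner_toH2_one_self, mul_one]
  have h2 : ⟪mulH2 β.fn (toH2 1),
      shift ((d / ⟪mulH2 β.fn (toH2 1), shift g⟫_ℂ) • g)⟫_ℂ = d := by
    rw [map_smul, H2.inner_smul_right, div_mul_cancel₀ _ hg']
  have h3 := norm_sq_opT θ β hθ a b (h := 0) (Submodule.smul_mem _ c he')
    (Submodule.smul_mem _ (d / ⟪mulH2 β.fn (toH2 1), shift g⟫_ℂ) hg)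
  rw [h1, h2] at h3
  have h4 := pow_le_pow_left₀ (norm_nonneg _) (h (mulH2 (θ.fn * β.fn) 0 + mulH2 β.fn (c • e) +
    (d / ⟪mulH2 β.fn (toH2 1), shift g⟫_ℂ) • g)) 2
  linarith

/-! ### Outer symbols and invertible symbols -/

theorem symbol_apply (θ : InnerFunction) (a b : ℂ) (t : UnitAddCircle) :
    (symbol θ a b : UnitAddCircle → ℂ) t = (a - b) + b * (θ.fn : UnitAddCircle → ℂ) t := by
  change a + b * ((θ.fn : UnitAddCircle → ℂ) t - 1) = _
  ring

theorem norm_lt_norm_sub {a b : ℂ} (h : 2 * (conj a * b).re ≤ -1) : ‖b‖ < ‖a - b‖ := by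
  refine lt_of_pow_lt_pow_left₀ 2 (norm_nonneg _) ?_
  have : ‖a - b‖ ^ 2 = ‖a‖ ^ 2 + ‖b‖ ^ 2 - 2 * (conj a * b).re := by
    simp only [← Complex.normSq_eq_norm_sq, Complex.normSq_apply, Complex.sub_re,
      Complex.sub_im, Complex.mul_re, Complex.conj_re, Complex.conj_im]
    ring
  nlinarith [sq_nonneg ‖a‖]

/-- φ = (a − b)(1 + bθ/(a − b)), where the second factor is inverted on H² by a Neumann series; the
preimage of the constant 1 is 1/φ. -/
theorem exists_mul_symbol_eq_one (θ : InnerFunction) {a b : ℂ} (hab : ‖b‖ < ‖a - b‖) :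
    ∃ ψ : hInfty, ((symbol θ a b * ψ : hInfty) : UnitAddCircle → ℂ) =ᵐ[circleMeasure] 1 := by
  have h0 : a - b ≠ 0 := norm_pos_iff.1 ((norm_nonneg b).trans_lt hab)
  set A : H2 →L[ℂ] H2 := (-(b / (a - b))) • mulH2 θ.fn with hA
  have hA1 : ‖A‖ < 1 := by
    refine (ContinuousLinearMap.opNorm_le_bound A (norm_nonneg (-(b / (a - b)))) fun x => ?_).trans_lt
      ?_
    · rw [hA, smul_apply, norm_smul, norm_mulH2]
    rw [norm_neg, norm_div]
    rwa [div_lt_one (norm_pos_iff.2 h0)]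
  set R := Units.oneSub A hA1 with hR
  set h : H2 := (a - b)⁻¹ • ((R⁻¹ : (H2 →L[ℂ] H2)ˣ) : H2 →L[ℂ] H2) (toH2 1) with hh
  have h1 : mulH2 (symbol θ a b) h = toH2 1 := by
    have e1 : ∀ x, mulH2 (symbol θ a b) x = (a - b) • (R : H2 →L[ℂ] H2) x := fun x => by
      rw [hR, Units.val_oneSub, sub_apply, one_apply_eq_self, hA,
        smul_apply, mulH2_symbol, smul_sub, smul_smul, mul_neg,
        mul_div_cancel₀ _ h0, neg_smul, sub_neg_eq_add]
    rw [e1, hh, map_smul, smul_inv_smul₀ h0, ← mul_apply_eq_comp, Units.mul_inv,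
      one_apply_eq_self]
  have h2 : ∀ᵐ t ∂circleMeasure, (symbol θ a b : UnitAddCircle → ℂ) t * (h : L2) t = 1 := by
    have e1 : (mulH2 (symbol θ a b) h : L2) = (toH2 1 : L2) := by rw [h1]
    filter_upwards [coeFn_mulH2 (symbol θ a b) h, (memLp_two (1 : hInfty).2.1).coeFn_toLp]
      with t h3 h4
    rw [← h3, e1]
    simp only [toH2, h4]
    simp
  -- So far 1/φ is only in H²; it is bounded since |φ| ≥ |a − b| − |b| on the circle.
  have h3 : MemLp (h : L2) ∞ circleMeasure := by
    refine memLp_top_of_bound (Lp.aestronglyMeasurable _) (‖a - b‖ - ‖b‖)⁻¹ ?_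
    filter_upwards [h2, θ.norm_eq_one] with t h3 h4
    rw [eq_inv_of_mul_eq_one_right h3, norm_inv]
    refine inv_anti₀ (sub_pos.2 hab) ?_
    rw [symbol_apply]
    have := norm_sub_le_norm_add (a - b) (b * (θ.fn : UnitAddCircle → ℂ) t)
    rwa [norm_mul, h4, mul_one] at this
  exact ⟨⟨_, h3, h.2⟩, h2⟩

/-! ### Jensen's formula and the consequence of outerness. -/

theorem fourierCoeff_zero_eq_inner (f : hInfty) :
    fourierCoeff (f : UnitAddCircle → ℂ) 0 = ⟪toH2 1, toH2 f⟫_ℂ := by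
  rw [inner_toH2_one]
  exact (congrFun (fourierCoeff_congr_ae (memLp_two f.2.1).coeFn_toLp) 0).symm

theorem integral_pow_eq_zero {θ : InnerFunction} (hθ : diskEval θ.fn 0 = 0) {n : ℕ} (hn : n ≠ 0) :
    ∫ t, (θ.fn : UnitAddCircle → ℂ) t ^ n ∂circleMeasure = 0 := by
  obtain ⟨m, rfl⟩ := Nat.exists_eq_succ_of_ne_zero hn
  have h1 := fourierCoeff_zero_eq_inner (θ.fn ^ (m + 1))
  rw [pow_succ', toH2_mul, inner_one_mulH2 hθ] at h1
  rw [← h1, fourierCoeff]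
  refine integral_congr_ae (Filter.Eventually.of_forall fun t => ?_)
  rw [← pow_succ']
  simp

/-- −log|1 − cθ| is the real part of ∑ (cθ)ⁿ/n, dominated by a geometric series, and each θⁿ with n
≥ 1 has mean θ(0)ⁿ = 0. -/
theorem integral_log_norm_one_sub {θ : InnerFunction} (hθ : diskEval θ.fn 0 = 0) {c : ℂ}
    (hc : ‖c‖ < 1) :
    ∫ t, Real.log ‖1 - c * (θ.fn : UnitAddCircle → ℂ) t‖ ∂circleMeasure = 0 := by
  have hm : AEStronglyMeasurable (θ.fn : UnitAddCircle → ℂ) circleMeasure := θ.fn.2.1.1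
  -- The term n = 0 is zero, by the convention 1/0 = 0.
  set F : ℕ → UnitAddCircle → ℂ := fun n t => (c * (θ.fn : UnitAddCircle → ℂ) t) ^ n / n with hF
  have hFm : ∀ n, AEStronglyMeasurable (F n) circleMeasure := fun n => by
    simp only [hF, div_eq_mul_inv]
    exact ((hm.const_mul c).pow n).mul_const _
  have hFb : ∀ n, ∀ᵐ t ∂circleMeasure, ‖F n t‖ ≤ ‖c‖ ^ n := fun n => by
    filter_upwards [θ.norm_eq_one] with t ht
    rw [hF, norm_div, norm_pow, norm_mul, ht, mul_one, Complex.norm_natCast]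
    rcases Nat.eq_zero_or_pos n with rfl | hn
    · simp
    · exact div_le_self (by positivity) (by exact_mod_cast hn)
  have hFi : ∀ n, Integrable (F n) circleMeasure := fun n =>
    Integrable.of_bound (hFm n) _ (hFb n)
  have h0 : ∀ n, ∫ t, (F n t).re ∂circleMeasure = 0 := fun n => by
    have h1 : ∫ t, F n t ∂circleMeasure = 0 := by
      rcases eq_or_ne n 0 with rfl | hn
      · simp [hF]
      · simp only [hF, mul_pow, integral_div, integral_const_mul, integral_pow_eq_zero hθ hn,
          mul_zero, zero_div]
    have h2 := integral_re (𝕜 := ℂ) (hFi n)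
    rw [h1] at h2
    simpa using h2
  have key := hasSum_integral_of_dominated_convergence (μ := circleMeasure)
    (F := fun n t => (F n t).re)
    (f := fun t => -Real.log ‖1 - c * (θ.fn : UnitAddCircle → ℂ) t‖) (fun n _ => ‖c‖ ^ n)
    (fun n => (hFi n).re.1)
    (fun n => by
      filter_upwards [hFb n] with t ht
      exact (Complex.abs_re_le_norm _).trans ht)
    (Filter.Eventually.of_forall fun _ => summable_geometric_of_lt_one (norm_nonneg _) hc)
    (integrable_const _)
    (by
      filter_upwards [θ.norm_eq_one] with t ht
      have h1 := Complex.hasSum_taylorSeries_neg_log (z := c * (θ.fn : UnitAddCircle → ℂ) t)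
        (by rwa [norm_mul, ht, mul_one])
      have h2 := Complex.hasSum_re h1
      rwa [Complex.neg_re, Complex.log_re] at h2)
  simp only [h0] at key
  have := key.unique hasSum_zero
  rwa [integral_neg, neg_eq_zero] at this

/-- If |a − b| < |b|, then φ = b(θ − l) with |l| < 1, and |θ − l| = |1 − l̄θ| on the circle, so
log|φ| has mean log|b|. The outer representation at z = 0 then gives |φ(0)| = |b|, contradicting
φ(0) = a − b. -/
theorem norm_le_of_isOuter_symbol {θ : InnerFunction} (hθ : diskEval θ.fn 0 = 0) {a b : ℂ}
    (h : IsOuter (symbol θ a b)) : ‖b‖ ≤ ‖a - b‖ := by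
  by_contra! hab
  obtain ⟨hi, c, hc, hz⟩ := h
  have hb : b ≠ 0 := norm_pos_iff.1 ((norm_nonneg _).trans_lt hab)
  set l := (b - a) / b with hl
  have hl1 : ‖l‖ < 1 := by
    rw [hl, norm_div, norm_sub_rev]
    exact (div_lt_one (norm_pos_iff.2 hb)).2 hab
  have h1 : ∀ᵐ t ∂circleMeasure, Real.log ‖1 - conj l * (θ.fn : UnitAddCircle → ℂ) t‖ =
      Real.log ‖(symbol θ a b : UnitAddCircle → ℂ) t‖ - Real.log ‖b‖ := by
    filter_upwards [θ.norm_eq_one] with t ht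
    set z := (θ.fn : UnitAddCircle → ℂ) t
    have e1 : (a - b) + b * z = b * (z - l) := by
      rw [hl]
      field_simp
      ring
    have e2 : ‖z - l‖ = ‖1 - conj l * z‖ := by
      have hz' : z * conj z = 1 := by
        rw [Complex.mul_conj, Complex.normSq_eq_norm_sq, ht]
        simp
      have : z - l = z * conj (1 - conj l * z) := by
        rw [map_sub, map_mul, map_one, Complex.conj_conj]
        linear_combination l * hz'
      rw [this, norm_mul, ht, one_mul, RCLike.norm_conj]
    have e3 : ‖1 - conj l * z‖ ≠ 0 := by
      rw [norm_ne_zero_iff, sub_ne_zero]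
      intro h
      have := congrArg norm h
      rw [norm_one, norm_mul, ht, mul_one, RCLike.norm_conj] at this
      linarith
    rw [symbol_apply, e1, norm_mul, e2, Real.log_mul (norm_ne_zero_iff.2 hb) e3,
      add_sub_cancel_left]
  have h2 : ∫ t, Real.log ‖(symbol θ a b : UnitAddCircle → ℂ) t‖ ∂circleMeasure =
      Real.log ‖b‖ := by
    have h3 := integral_log_norm_one_sub hθ (c := conj l) (by rwa [RCLike.norm_conj])
    rw [integral_congr_ae h1, integral_sub hi (integrable_const _), integral_const] at h3
    simpa [sub_eq_zero] using h3
  have h3 : diskEval (symbol θ a b) 0 = a - b := by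
    rw [diskEval_zero, fourierCoeff_zero_eq_inner, toH2_eq_mulH2_one (symbol θ a b), mulH2_symbol,
      inner_add_right, H2.inner_smul_right, H2.inner_smul_right, inner_one_mulH2 hθ,
      inner_toH2_one_self, mul_zero, add_zero, mul_one]
  have h4 := hz 0 (by simp)
  have h5 : ∫ t : UnitAddCircle, (fourier 1 t + 0) / (fourier 1 t - 0) *
      (Real.log ‖(symbol θ a b : UnitAddCircle → ℂ) t‖ : ℂ) ∂circleMeasure =
      ((Real.log ‖b‖ : ℝ) : ℂ) := by
    rw [← h2, ← integral_complex_ofReal]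
    refine integral_congr_ae (Filter.Eventually.of_forall fun t => ?_)
    have : (fourier 1 t : ℂ) ≠ 0 := by
      rw [fourier_apply]
      exact Circle.coe_ne_zero _
    simp only [add_zero, sub_zero]
    rw [div_self this, one_mul]
  rw [h3, h5, ← Complex.ofReal_exp, Real.exp_log (norm_pos_iff.2 hb)] at h4
  have h6 := congrArg norm h4
  rw [norm_mul, hc, one_mul, Complex.norm_real, norm_norm] at h6
  linarith

theorem sub_ne_zero_of_symbol {θ : InnerFunction} {a b : ℂ}
    (hφ : ¬ (symbol θ a b : UnitAddCircle → ℂ) =ᵐ[circleMeasure] 0) (hab : ‖b‖ ≤ ‖a - b‖) :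
    a - b ≠ 0 := by
  intro h
  rw [h, norm_zero, norm_le_zero_iff] at hab
  refine hφ (Filter.Eventually.of_forall fun t => ?_)
  rw [symbol_apply, h, hab, zero_mul, add_zero]
  rfl

end HardySpace

end

open HardySpace

theorem mainTheorem5 (θ β : InnerFunction) (hθ : diskEval θ.fn 0 = 0) (a b : ℂ)
    (hφ : ¬ ((symbol θ a b : UnitAddCircle → ℂ) =ᵐ[circleMeasure] 0)) :
    -- the operators `X` and `Y` are given by the formulas that define them
    (∀ h f g : H2, f ∈ modelSpace θ.fn → g ∈ modelSpace β.fn →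
      opX θ β a b (mulH2 (θ.fn * β.fn) h + mulH2 β.fn f + g) =
        mulH2 ((θ.fn - 1) * β.fn) h + a • mulH2 β.fn f + mulH2 (symbol θ a b) g) ∧
    (∀ h g : H2, g ∈ modelSpace β.fn →
      opY θ β a b (mulH2 β.fn h + g) =
        mulH2 (θ.fn * β.fn * symbol θ a b) h +
          mulH2 θ.fn ((rangeH2 β.fn).starProjection (mulH2 (symbol θ a b) g)) +
          mulH2 (θ.fn - 1) g) ∧
    -- invariant subspaces of `T`, and the compression of `T` to `β K_θ`
    InLat (opT θ β hθ a b) (rangeH2 (θ.fn * β.fn)) ∧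
    InLat (opT θ β hθ a b) (rangeH2 β.fn) ∧
    UnitarilyEquivalent (E := mulSubmodule β (modelSpace θ.fn)) (F := modelSpace θ.fn)
      (compression (opT θ β hθ a b) (mulSubmodule β (modelSpace θ.fn))) (clarkU θ hθ) ∧
    -- intertwining relations
    opY θ β a b ∘L shift = opT θ β hθ a b ∘L opY θ β a b ∧
    opX θ β a b ∘L opT θ β hθ a b = shift ∘L opX θ β a b ∧
    (opY θ β a b).ker = ⊥ ∧
    -- (i)
    (IsOuter (symbol θ a b) → a ≠ 0 → IsQuasiaffinity (opX θ β a b)) ∧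
    -- (ii)
    (IsOuter (symbol θ a b) →
      ((modelSpace β.fn).map (mulH2 (θ.fn - 1)).toLinearMap).topologicalClosure =
        modelSpace (θ.fn * β.fn) →
      IsQuasiaffinity (opY θ β a b)) ∧
    -- (iii)
    ((¬ ∃ c : ℂ, (β.fn : UnitAddCircle → ℂ) =ᵐ[circleMeasure] fun _ => c) →
      (IsExpansive (opT θ β hθ a b) ↔ 2 * (starRingEnd ℂ a * b).re ≤ -1)) ∧
    (2 * (starRingEnd ℂ a * b).re ≤ -1 →
      IsExpansive (opT θ β hθ a b) ∧
      ∃ ψ : hInfty, ((symbol θ a b * ψ : hInfty) : UnitAddCircle → ℂ) =ᵐ[circleMeasure] 1) := by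

  refine ⟨opX_apply θ β a b, opY_apply θ β a b, inLat_rangeH2_mul θ β hθ a b,
    inLat_rangeH2 θ β hθ a b, unitarilyEquivalent_compression θ β hθ a b,
    opY_comp_shift θ β hθ a b, opX_comp_opT θ β hθ a b, ker_opY θ β hθ a b hφ,
    fun ho ha => ?_, fun ho hc => ⟨ker_opY θ β hθ a b hφ, ?_⟩,
    fun hβ => isExpansive_opT_iff θ hθ hβ a b,
    fun h => ⟨isExpansive_opT θ β hθ h, exists_mul_symbol_eq_one θ (norm_lt_norm_sub h)⟩⟩
  · have hab := norm_le_of_isOuter_symbol hθ ho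
    exact isQuasiaffinity_opX θ β hθ hab (sub_ne_zero_of_symbol hφ hab) ha
  · have hab := norm_le_of_isOuter_symbol hθ ho
    exact denseRange_opY θ β hθ hab (sub_ne_zero_of_symbol hφ hab) hc
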